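/- Let $X$ be a noetherian scheme with the resolution property, i.e. every coherent sheaf on $X$ is a quotient of a locally free sheaf of finite rank. Let $\mathrm{Coh}(X)$ be the category of coherent sheaves on $X$ and $\mathrm{Bun}(X)\subset \mathrm{Coh}(X)$ the full subcategory of locally free sheaves of finite rank (the rank need not be constant). Then: (1) $\mathrm{Coh}(X)$ is an abelian category, $\mathrm{Bun}(X)$ is closed under extensions in $\mathrm{Coh}(X)$, and $\mathrm{Bun}(X)$ is an exact category in the sense of Quillen, with conflations the short exact sequences of $\mathrm{Coh}(X)$ all of whose terms lie in $\mathrm{Bun}(X)$. (2) The inclusion $i\colon \mathrm{Bun}(X)\to\mathrm{Coh}(X)$ is the right abelian envelope of the exact category $\mathrm{Bun}(X)$: the functor $i$ is right exact and, for every abelian category $\mathcal{B}$, precomposition with $i$ is an equivalence of categories $$(-)\circ i\colon \mathrm{Rex}(\mathrm{Coh}(X),\mathcal{B})\xrightarrow{\ \simeq\ }\mathrm{Rex}(\mathrm{Bun}(X),\mathcal{B}).$$ Here an abelian category is regarded as an exact category whose conflations are all short exact sequences. An additive functor $\Psi\colon\mathcal{E}\to\mathcal{E}'$ between exact categories is right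 exact if, for every conflation $X\xrightarrow{i}Y\xrightarrow{d}Z$ in $\mathcal{E}$, the morphism $\Psi(d)$ is a deflation with kernel $i'\colon X'\to\Psi(Y)$ and $\Psi(i)=i'\circ d'$ for some deflation $d'\colon\Psi(X)\to X'$. $\mathrm{Rex}(\mathcal{E},\mathcal{E}')$ denotes the category of right exact functors $\mathcal{E}\to\mathcal{E}'$ with natural transformations as morphisms. -/

import Mathlib

open CategoryTheory CategoryTheory.Limits

universe u w t v₁ v₂ v₃ u₁ u₂ u₃

noncomputable section

namespace AbelianEnvelope

section ExactCategories

variable {E : Type u₁} [Category.{v₁} E] [Preadditive E]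

/-- `d` is a deflation for the class of conflations `S`. -/
def IsDeflation (S : ObjectProperty (ShortComplex E)) {Y Z : E} (d : Y ⟶ Z) : Prop :=
  ∃ (X : E) (i : X ⟶ Y) (h : i ≫ d = 0), S (ShortComplex.mk i d h)

/-- `i` is an inflation for the class of conflations `S`. -/
def IsInflation (S : ObjectProperty (ShortComplex E)) {X Y : E} (i : X ⟶ Y) : Prop :=
  ∃ (Z : E) (d : Y ⟶ Z) (h : i ≫ d = 0), S (ShortComplex.mk i d h)

/-- The class `S` of conflations makes the preadditive category `E` into an exact category
(in the sense of Quillen, with Keller's axioms). -/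
structure IsExactCategory (S : ObjectProperty (ShortComplex E)) : Prop where
  /-- `E` is additive -/
  hasFiniteBiproducts : HasFiniteBiproducts E
  closedUnderIso : S.IsClosedUnderIsomorphisms
  /-- in a conflation `X ⟶ Y ⟶ Z`, the first map is a kernel of the second -/
  isKernel : ∀ T : ShortComplex E, S T → Nonempty (IsLimit (KernelFork.ofι T.f T.zero))
  /-- in a conflation `X ⟶ Y ⟶ Z`, the second map is a cokernel of the first -/
  isCokernel : ∀ T : ShortComplex E, S T → Nonempty (IsColimit (CokernelCofork.ofπ T.g T.zero))
  /-- `0 ⟶ X ⟶ X` is a conflation -/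
  ex0 : ∀ (O X : E), IsZero O → S (ShortComplex.mk (0 : O ⟶ X) (𝟙 X) zero_comp)
  /-- the composite of two deflations is a deflation -/
  ex1 : ∀ {X Y Z : E} (f : X ⟶ Y) (g : Y ⟶ Z),
    IsDeflation S f → IsDeflation S g → IsDeflation S (f ≫ g)
  /-- the pullback of a deflation along any morphism exists and is a deflation -/
  ex2 : ∀ {Y Z Z' : E} (d : Y ⟶ Z) (f : Z' ⟶ Z), IsDeflation S d →
    ∃ (Y' : E) (f' : Y' ⟶ Y) (d' : Y' ⟶ Z'), IsPullback f' d' d f ∧ IsDeflation S d'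
  /-- the pushout of an inflation along any morphism exists and is an inflation -/
  ex2' : ∀ {X Y X' : E} (i : X ⟶ Y) (f : X ⟶ X'), IsInflation S i →
    ∃ (Y' : E) (f' : Y ⟶ Y') (i' : X' ⟶ Y'), IsPushout i f f' i' ∧ IsInflation S i'

variable (E) in
/-- The conflations of an abelian category: all short exact sequences. -/
def shortExactSequences : ObjectProperty (ShortComplex E) :=
  fun T => T.ShortExact

/-- The conflations of `E` all of whose terms lie in the full subcategory `P`. -/
def inducedConflations (S : ObjectProperty (ShortComplex E)) (P : ObjectProperty E) :
    ObjectProperty (ShortComplex P.FullSubcategory) :=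
  fun T => S (T.map P.ι)

variable (E) in
/-- The preadditive category `E` is an abelian category. -/
def IsAbelianCategory : Prop :=
  ∃ h : Abelian E, h.toPreadditive = (inferInstance : Preadditive E)

end ExactCategories

section RightExactFunctors

variable {E : Type u₁} [Category.{v₁} E] [Preadditive E]
variable {E' : Type u₂} [Category.{v₂} E'] [Preadditive E']
variable {E'' : Type u₃} [Category.{v₃} E''] [Preadditive E'']

/-- An additive functor `Ψ` between exact categories is right exact if, for any conflation
`X ⟶ Y ⟶ Z` with maps `i` and `d`, the map `Ψ(d)` is a deflation with kernel
`i' : X' ⟶ Ψ(Y)`, and `Ψ(i)` is the composite of a deflation `d' : Ψ(X) ⟶ X'` with `i'`. -/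
structure IsRightExact (S : ObjectProperty (ShortComplex E)) (S' : ObjectProperty (ShortComplex E'))
    (Ψ : E ⥤ E') : Prop where
  additive : Ψ.Additive
  map_conflation : ∀ T : ShortComplex E, S T →
    ∃ (X' : E') (i' : X' ⟶ Ψ.obj T.X₂) (h : i' ≫ Ψ.map T.g = 0) (d' : Ψ.obj T.X₁ ⟶ X'),
      S' (ShortComplex.mk i' (Ψ.map T.g) h) ∧ IsDeflation S' d' ∧ Ψ.map T.f = d' ≫ i'

lemma IsRightExact.map_deflation {S : ObjectProperty (ShortComplex E)}
    {S' : ObjectProperty (ShortComplex E')} {Ψ : E ⥤ E'} (hΨ : IsRightExact S S' Ψ)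
    {Y Z : E} {d : Y ⟶ Z} (hd : IsDeflation S d) : IsDeflation S' (Ψ.map d) := by
  obtain ⟨X, i, h, hS⟩ := hd
  obtain ⟨X', i', h', _, hS', _⟩ := hΨ.map_conflation _ hS
  exact ⟨X', i', h', hS'⟩

lemma IsRightExact.comp {S : ObjectProperty (ShortComplex E)}
    {S' : ObjectProperty (ShortComplex E')} {S'' : ObjectProperty (ShortComplex E'')}
    (hS'' : ∀ {X Y Z : E''} (f : X ⟶ Y) (g : Y ⟶ Z),
      IsDeflation S'' f → IsDeflation S'' g → IsDeflation S'' (f ≫ g))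
    {Ψ : E ⥤ E'} {Φ : E' ⥤ E''} (hΨ : IsRightExact S S' Ψ) (hΦ : IsRightExact S' S'' Φ) :
    IsRightExact S S'' (Ψ ⋙ Φ) where
  additive := by
    have := hΨ.additive
    have := hΦ.additive
    infer_instance
  map_conflation T hT := by
    obtain ⟨X', i', h', d', hc', hd', e'⟩ := hΨ.map_conflation T hT
    obtain ⟨X'', i'', h'', d'', hc'', hd'', e''⟩ := hΦ.map_conflation _ hc'
    refine ⟨X'', i'', h'', Φ.map d' ≫ d'', hc'', hS'' _ _ (hΦ.map_deflation hd') hd'', ?_⟩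
    dsimp at e'' ⊢
    rw [e', Φ.map_comp, e'', Category.assoc]

lemma isDeflation_shortExactSequences_iff {B : Type u₁} [Category.{v₁} B] [Abelian B]
    {Y Z : B} (d : Y ⟶ Z) : IsDeflation (shortExactSequences B) d ↔ Epi d := by
  constructor
  · rintro ⟨X, i, h, hS⟩
    exact hS.epi_g
  · intro _
    exact ⟨kernel d, kernel.ι d, kernel.condition d,
      { exact := ShortComplex.exact_of_f_is_kernel _ (kernelIsKernel d)
        mono_f := by dsimp; infer_instance
        epi_g := by dsimp; infer_instance }⟩

lemma isDeflation_shortExactSequences_comp {B : Type u₁} [Category.{v₁} B] [Abelian B]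
    {X Y Z : B} (f : X ⟶ Y) (g : Y ⟶ Z) (hf : IsDeflation (shortExactSequences B) f)
    (hg : IsDeflation (shortExactSequences B) g) :
    IsDeflation (shortExactSequences B) (f ≫ g) := by
  rw [isDeflation_shortExactSequences_iff] at hf hg ⊢
  exact epi_comp f g

/-- The category `Rex` of right exact functors, with natural transformations as morphisms. -/
abbrev Rex (S : ObjectProperty (ShortComplex E)) (S' : ObjectProperty (ShortComplex E')) :=
  ObjectProperty.FullSubcategory (C := E ⥤ E') (fun Ψ => IsRightExact S S' Ψ)

/-- Precomposition with a right exact functor `i`, as a functor between the categories of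
right exact functors with values in an abelian category `B`. -/
def rexPrecomp {S : ObjectProperty (ShortComplex E)} {S' : ObjectProperty (ShortComplex E')}
    {i : E ⥤ E'} (hi : IsRightExact S S' i) (B : Type u₃) [Category.{v₃} B] [Abelian B] :
    Rex S' (shortExactSequences B) ⥤ Rex S (shortExactSequences B) :=
  ObjectProperty.lift _ (ObjectProperty.ι _ ⋙ (Functor.whiskeringLeft E E' B).obj i)
    (fun G => hi.comp isDeflation_shortExactSequences_comp G.property)

/-- The functor `i : E ⥤ A` exhibits `A` as the right abelian envelope of the exact category `E`
with class of conflations `S`: the category `A` is abelian, `i` is right exact, and for every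
abelian category `B`, precomposition with `i` is an equivalence from the category of right exact
functors `A ⥤ B` to the category of right exact functors `E ⥤ B`. -/
structure IsRightAbelianEnvelope {A : Type u₂} [Category.{v₂} A] [Preadditive A]
    (S : ObjectProperty (ShortComplex E)) (i : E ⥤ A) : Prop where
  isAbelian : IsAbelianCategory A
  isExactCategory : IsExactCategory S
  isRightExact : IsRightExact S (shortExactSequences A) i
  isEquivalence : ∀ (B : Type w) [Category.{t} B] [Abelian B],
    (rexPrecomp isRightExact B).IsEquivalence

end RightExactFunctors

section Sheaves

open AlgebraicGeometry

variable (X : Scheme.{u})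

/-- Coherent sheaves on a (locally) noetherian scheme: quasi-coherent sheaves of modules of
finite type. -/
def isCoherent : ObjectProperty X.Modules :=
  fun F => SheafOfModules.IsQuasicoherent (R := X.ringCatSheaf) F ∧
    SheafOfModules.IsFiniteType (R := X.ringCatSheaf) F

/-- Locally free sheaves of finite rank: there is an open covering of `X` on each member of
which the sheaf is isomorphic to a free sheaf on a finite set of sections (whose cardinality may
vary with the member of the covering). -/
def isLocallyFreeOfFiniteRank : ObjectProperty X.Modules :=
  fun F => ∃ q : SheafOfModules.LocalGeneratorsData.{u} (R := X.ringCatSheaf) F,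
    q.IsLocallyFreeData ∧ q.IsFiniteType

/-- The category of coherent sheaves on `X`. -/
abbrev Coh := (isCoherent X).FullSubcategory

/-- The locally free sheaves of finite rank, among the coherent sheaves. -/
def isBun : ObjectProperty (Coh X) :=
  fun F => isLocallyFreeOfFiniteRank X F.obj

/-- The category of locally free sheaves of finite rank, a full subcategory of `Coh X`. -/
abbrev Bun := (isBun X).FullSubcategory

/-- The exact structure on `Bun X` induced from `Coh X`. -/
def bunConflations : ObjectProperty (ShortComplex (Bun X)) :=
  inducedConflations (shortExactSequences (Coh X)) (isBun X)

/-- Every coherent sheaf is a quotient of a locally free sheaf of finite rank. -/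
def HasResolutionProperty : Prop :=
  ∀ F : X.Modules, isCoherent X F →
    ∃ (V : X.Modules) (p : V ⟶ F), isLocallyFreeOfFiniteRank X V ∧ Epi p

end Sheaves

end AbelianEnvelope

end

/-!
Let `P` be a full subcategory of an abelian category `A` which contains zero, is closed under
extensions and under kernels of epimorphisms, and such that every object of `A` is a quotient of an
object of `P` (`IsResolving P`). Then `P` is an exact category and `A` is its right abelian envelope
(`IsResolving.isRightAbelianEnvelope`). Indeed, every object `X` of `A` has a presentation
`P₁ ⟶ P₀ ⟶ X ⟶ 0` by objects of `P`, so a right exact functor `G` on `A` is determined by its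
restriction `F` to `P`: its value at `X` is the cokernel of `F P₁ ⟶ F P₀`. Lifting morphisms along
epimorphisms after refinement by objects of `P` shows that, for every right exact functor `F` on
`P`, this cokernel is the colimit computing the pointwise left Kan extension of `F` at `X`
(`IsResolving.isColimitOfIsCokernel`), and that this Kan extension is right exact
(`IsResolving.isRightExact_leftExtension`). Hence left Kan extension along the inclusion is inverse
to restriction.

It remains to see that the locally free sheaves of finite rank form such a subcategory of the
coherent sheaves on a noetherian scheme with the resolution property (`isResolving_isBun`). Both
classes of sheaves are described by their sections over small affine open subsets, given as open
immersions `j : Spec R ⟶ X`: among quasi-coherent modules, the coherent ones are those whose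
sections are locally finite modules (`exists_finite_affineSections`,
`isCoherent_of_affineSections`),
and the locally free ones of finite rank are those whose sections are locally finite projective
(`exists_free_affineSections`, `isLocallyFreeOfFiniteRank_of_affineSections`). Sections over an
affine open subset are exact on quasi-coherent modules (`shortExact_map_affineSections`), so the
closure properties reduce to facts on modules: submodules of finite modules over a noetherian ring
are finite, and short exact sequences with projective third term split.
-/

noncomputable section

namespace AbelianEnvelope

/-! ### Resolving subcategories and their exact structure -/

lemma isClosedUnderFiniteProducts_of_biprod {C : Type u₁} [Category.{v₁} C] [Preadditive C]
    [HasFiniteProducts C] [HasBinaryBiproducts C] (P : ObjectProperty C) [P.ContainsZero]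
    [P.IsClosedUnderIsomorphisms] (h : ∀ X Y : C, P X → P Y → P (X ⊞ Y)) :
    P.IsClosedUnderFiniteProducts := by
  have : P.IsClosedUnderBinaryProducts := ⟨by
    rintro X ⟨c⟩
    exact P.prop_of_iso (IsLimit.conePointsIsoOfNatIso (BinaryBiproduct.isLimit _ _) c.isLimit
      (diagramIsoPair c.diag).symm) (h _ _ (c.prop_diag_obj ⟨.left⟩) (c.prop_diag_obj ⟨.right⟩))⟩
  exact .mk'

/-- A full subcategory `P` of an abelian category is resolving if it contains zero, is closed
under extensions and under kernels of epimorphisms, and every object is a quotient of an object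
of `P`. The kernel condition is stated for the first term of a short exact sequence, so that it
does not depend on a choice of kernels. -/
structure IsResolving {A : Type u₁} [Category.{v₁} A] [Abelian A] (P : ObjectProperty A) :
    Prop where
  containsZero : P.ContainsZero
  closedUnderExtensions : P.IsClosedUnderExtensions
  prop_X₁ : ∀ {T : ShortComplex A}, T.ShortExact → P T.X₂ → P T.X₃ → P T.X₁
  exists_epi : ∀ X : A, ∃ (V : A) (p : V ⟶ X), P V ∧ Epi p

namespace IsResolving

variable {A : Type u₁} [Category.{v₁} A] [Abelian A] {P : ObjectProperty A} (hP : IsResolving P)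
variable {B : Type u₂} [Category.{v₂} B] [Abelian B]

lemma shortExact_kernel {C : Type u₁} [Category.{v₁} C] [Abelian C] {Y Z : C} (d : Y ⟶ Z) [Epi d] :
    (ShortComplex.mk (kernel.ι d) d (kernel.condition d)).ShortExact :=
  { exact := ShortComplex.exact_of_f_is_kernel _ (kernelIsKernel d)
    mono_f := by dsimp; infer_instance
    epi_g := by dsimp; infer_instance }

lemma shortExact_cokernel {C : Type u₁} [Category.{v₁} C] [Abelian C] {Y Z : C} (d : Y ⟶ Z)
    [Mono d] :
    (ShortComplex.mk d (cokernel.π d) (cokernel.condition d)).ShortExact :=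
  { exact := ShortComplex.exact_of_g_is_cokernel _ (cokernelIsCokernel d)
    mono_f := by dsimp; infer_instance
    epi_g := by dsimp; infer_instance }

include hP

lemma isClosedUnderIsomorphisms : P.IsClosedUnderIsomorphisms where
  of_iso {X Y} e hX := by
    have := hP.containsZero
    have := hP.closedUnderExtensions
    obtain ⟨O, hO, hPO⟩ := P.exists_prop_of_containsZero
    let T : ShortComplex A := ShortComplex.mk e.hom (0 : Y ⟶ O) comp_zero
    have hT : T.ShortExact :=
      { exact := (ShortComplex.exact_iff_epi T rfl).2 (by dsimp [T]; infer_instance)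
        mono_f := by dsimp [T]; infer_instance
        epi_g := hO.epi _ }
    exact P.prop_X₂_of_shortExact hT hX hPO

/-- Since `P` is closed under kernels of epimorphisms, the deflations between objects of `P`
are the epimorphisms of the ambient category. -/
lemma isDeflation_iff {Y Z : P.FullSubcategory} (d : Y ⟶ Z) :
    IsDeflation (inducedConflations (shortExactSequences A) P) d ↔ Epi d.hom := by
  constructor
  · rintro ⟨X, i, h, hS⟩
    exact ShortComplex.ShortExact.epi_g hS
  · intro _
    exact ⟨⟨kernel d.hom, hP.prop_X₁ (shortExact_kernel d.hom) Y.2 Z.2⟩,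
      P.homMk (kernel.ι d.hom), by ext; exact kernel.condition _, shortExact_kernel d.hom⟩

lemma isInflation_iff {X Y : P.FullSubcategory} (i : X ⟶ Y) :
    IsInflation (inducedConflations (shortExactSequences A) P) i ↔
      Mono i.hom ∧ P (cokernel i.hom) := by
  constructor
  · rintro ⟨Z, d, h, hS⟩
    have hS : (ShortComplex.mk i.hom d.hom (congrArg (·.hom) h)).ShortExact := hS
    have := hP.isClosedUnderIsomorphisms
    refine ⟨hS.mono_f, P.prop_of_iso ?_ Z.2⟩
    exact hS.gIsCokernel.coconePointUniqueUpToIso (colimit.isColimit (parallelPair i.hom 0))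
  · rintro ⟨_, h⟩
    exact ⟨⟨_, h⟩, P.homMk (cokernel.π i.hom), by ext; exact cokernel.condition _,
      shortExact_cokernel i.hom⟩

lemma hasFiniteBiproducts : HasFiniteBiproducts P.FullSubcategory := by
  have := hP.containsZero
  have := hP.closedUnderExtensions
  have := hP.isClosedUnderIsomorphisms
  have := isClosedUnderFiniteProducts_of_biprod P fun _ _ h₁ h₂ => P.prop_biprod h₁ h₂
  exact HasFiniteBiproducts.of_hasFiniteProducts

/-- A resolving subcategory inherits an exact structure from the abelian category: deflations are
the epimorphisms, inflations are the monomorphisms with cokernel in `P`, and pullbacks and pushouts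
can be computed in the abelian category because they do not change kernels and cokernels. -/
lemma isExactCategory : IsExactCategory (inducedConflations (shortExactSequences A) P) where
  hasFiniteBiproducts := hP.hasFiniteBiproducts
  closedUnderIso := ⟨fun e h => ShortComplex.shortExact_of_iso (P.ι.mapShortComplex.mapIso e) h⟩
  isKernel T hT := by
    have hT : (T.map P.ι).ShortExact := hT
    exact ⟨isLimitOfReflects P.ι ((KernelFork.isLimitMapConeEquiv _ _).symm hT.fIsKernel)⟩
  isCokernel T hT := by
    have hT : (T.map P.ι).ShortExact := hT
    exact ⟨isColimitOfReflects P.ι ((CokernelCofork.isColimitMapCoconeEquiv _ _).symm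
      hT.gIsCokernel)⟩
  ex0 O X hO := by
    have hO' : IsZero O.obj := P.ι.map_isZero hO
    let T : ShortComplex A := ShortComplex.mk (0 : O.obj ⟶ X.obj) (𝟙 X.obj) zero_comp
    have hT : T.ShortExact :=
      { exact := (ShortComplex.exact_iff_mono T rfl).2 (by dsimp [T]; infer_instance)
        mono_f := hO'.mono _
        epi_g := by dsimp [T]; infer_instance }
    exact hT
  ex1 f g hf hg := by
    rw [hP.isDeflation_iff] at *
    exact epi_comp f.hom g.hom
  ex2 {Y Z Z'} d f hd := by
    rw [hP.isDeflation_iff] at hd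
    have := hP.closedUnderExtensions
    have := hP.isClosedUnderIsomorphisms
    have sq := IsPullback.of_hasPullback f.hom d.hom
    have := isIso_kernel_map_of_isPullback sq
    have hk : P (kernel (pullback.fst f.hom d.hom)) :=
      P.prop_of_iso (asIso (kernel.map _ _ _ _ sq.w)).symm
        (hP.prop_X₁ (shortExact_kernel d.hom) Y.2 Z.2)
    have hY' : P (pullback f.hom d.hom) :=
      P.prop_X₂_of_shortExact (shortExact_kernel (pullback.fst f.hom d.hom)) hk Z'.2
    refine ⟨⟨_, hY'⟩, P.homMk (pullback.snd _ _), P.homMk (pullback.fst _ _),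
      IsPullback.of_map P.ι (by ext; exact sq.w.symm) sq.flip, ?_⟩
    rw [hP.isDeflation_iff]
    exact inferInstanceAs (Epi (pullback.fst f.hom d.hom))
  ex2' {X Y X'} i f hi := by
    rw [hP.isInflation_iff] at hi
    obtain ⟨_, hi⟩ := hi
    have := hP.closedUnderExtensions
    have := hP.isClosedUnderIsomorphisms
    have sq := IsPushout.of_hasPushout i.hom f.hom
    have := isIso_cokernel_map_of_isPushout sq
    have hk : P (cokernel (pushout.inr i.hom f.hom)) :=
      P.prop_of_iso (asIso (cokernel.map _ _ _ _ sq.w)) hi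
    have hY' : P (pushout i.hom f.hom) :=
      P.prop_X₂_of_shortExact (shortExact_cokernel (pushout.inr i.hom f.hom)) X'.2 hk
    refine ⟨⟨_, hY'⟩, P.homMk (pushout.inl _ _), P.homMk (pushout.inr _ _),
      IsPushout.of_map P.ι (by ext; exact sq.w) sq, ?_⟩
    rw [hP.isInflation_iff]
    exact ⟨inferInstanceAs (Mono (pushout.inr i.hom f.hom)), hk⟩

omit hP in
lemma isRightExact_ι : IsRightExact (inducedConflations (shortExactSequences A) P)
    (shortExactSequences A) P.ι where
  additive := inferInstance
  map_conflation T hT := ⟨T.X₁.obj, T.f.hom, congrArg (·.hom) T.zero, 𝟙 _, hT,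
    (isDeflation_shortExactSequences_iff _).2 inferInstance, (Category.id_comp _).symm⟩

/-- A morphism from an object of `P` lifts along an epimorphism after composition with an
epimorphism in `P`: cover the pullback by an object of `P`. -/
lemma exists_lift {V : P.FullSubcategory} {X Y : A} (f : V.obj ⟶ Y) (g : X ⟶ Y) [Epi g] :
    ∃ (U : P.FullSubcategory) (e : U ⟶ V) (x : U.obj ⟶ X), Epi e.hom ∧ e.hom ≫ f = x ≫ g := by
  obtain ⟨U, p, hU, _⟩ := hP.exists_epi (pullback f g)
  exact ⟨⟨U, hU⟩, P.homMk (p ≫ pullback.fst f g), p ≫ pullback.snd f g,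
    by dsimp; infer_instance, by simp [pullback.condition]⟩

/-- The analogue of `exists_lift` for an exact sequence: a morphism from an object of `P` that is
killed by `T.g` lifts to `T.X₁` after composition with an epimorphism in `P`. -/
lemma exists_lift_of_exact {T : ShortComplex A} (hT : T.Exact) {V : P.FullSubcategory}
    (f : V.obj ⟶ T.X₂) (hf : f ≫ T.g = 0) :
    ∃ (U : P.FullSubcategory) (e : U ⟶ V) (x : U.obj ⟶ T.X₁),
      Epi e.hom ∧ e.hom ≫ f = x ≫ T.f := by
  obtain ⟨A', π, _, x₁, h⟩ := hT.exact_up_to_refinements f hf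
  obtain ⟨U, p, hU, _⟩ := hP.exists_epi A'
  exact ⟨⟨U, hU⟩, P.homMk (p ≫ π), p ≫ x₁, by dsimp; infer_instance, by simp [h]⟩

/-- A presentation of `X` by objects of `P`. -/
lemma exists_presentation (X : A) :
    ∃ (P₁ P₀ : P.FullSubcategory) (a : P₁ ⟶ P₀) (p : P₀.obj ⟶ X) (w : a.hom ≫ p = 0),
      Epi p ∧ (ShortComplex.mk a.hom p w).Exact := by
  obtain ⟨P₀, p, hP₀, _⟩ := hP.exists_epi X
  obtain ⟨P₁, q, hP₁, _⟩ := hP.exists_epi (kernel p)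
  refine ⟨⟨P₁, hP₁⟩, ⟨P₀, hP₀⟩, P.homMk (q ≫ kernel.ι p), p, by simp, inferInstance, ?_⟩
  rw [ShortComplex.exact_iff_epi_kernel_lift]
  convert (inferInstance : Epi q)
  ext; simp

end IsResolving

/-! ### Right exact functors on a resolving subcategory and their Kan extensions -/

section

variable {E : Type u₁} [Category.{v₁} E] [Preadditive E] {S : ObjectProperty (ShortComplex E)}
variable {B : Type u₂} [Category.{v₂} B] [Abelian B] {F : E ⥤ B}

/-- A right exact functor to an abelian category sends conflations to cokernel sequences. -/
lemma IsRightExact.exists_desc (hF : IsRightExact S (shortExactSequences B) F)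
    {T : ShortComplex E} (hT : S T) {Z : B} (φ : F.obj T.X₂ ⟶ Z) (hφ : F.map T.f ≫ φ = 0) :
    ∃ ψ : F.obj T.X₃ ⟶ Z, F.map T.g ≫ ψ = φ := by
  obtain ⟨X', i', h, d', hS', hd', e⟩ := hF.map_conflation T hT
  have hS' : (ShortComplex.mk i' (F.map T.g) h).ShortExact := hS'
  rw [isDeflation_shortExactSequences_iff] at hd'
  have : i' ≫ φ = 0 := by
    rw [e, Category.assoc] at hφ
    exact zero_of_epi_comp d' hφ
  exact ⟨hS'.gIsCokernel.desc (CokernelCofork.ofπ φ this), hS'.gIsCokernel.fac _ .one⟩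

/-- Converse to `IsRightExact.exists_desc`. -/
lemma isRightExact_of_exists_desc (hF : F.Additive)
    (hS : ∀ T : ShortComplex E, S T → Epi (F.map T.g))
    (h : ∀ (T : ShortComplex E), S T → ∀ {Z : B} (φ : F.obj T.X₂ ⟶ Z), F.map T.f ≫ φ = 0 →
      ∃ ψ : F.obj T.X₃ ⟶ Z, F.map T.g ≫ ψ = φ) :
    IsRightExact S (shortExactSequences B) F where
  additive := hF
  map_conflation T hT := by
    have := hS T hT
    have w : F.map T.f ≫ F.map T.g = 0 := by rw [← F.map_comp, T.zero, F.map_zero]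
    have ex : (ShortComplex.mk _ _ w).Exact := by
      refine ShortComplex.exact_of_g_is_cokernel _ (CokernelCofork.IsColimit.ofπ' _ _ ?_)
      intro Z φ hφ
      exact ⟨(h T hT φ hφ).choose, (h T hT φ hφ).choose_spec⟩
    refine ⟨kernel (F.map T.g), kernel.ι _, kernel.condition _, kernel.lift _ _ w,
      IsResolving.shortExact_kernel _, ?_, by simp⟩
    rw [isDeflation_shortExactSequences_iff]
    exact ex.epi_kernelLift

end

namespace IsResolving

variable {A : Type u₁} [Category.{v₁} A] [Abelian A] {P : ObjectProperty A} (hP : IsResolving P)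
variable {B : Type u₂} [Category.{v₂} B] [Abelian B]

section

variable {F : P.FullSubcategory ⥤ B}
  (hF : IsRightExact (inducedConflations (shortExactSequences A) P) (shortExactSequences B) F)

include hP hF

lemma epi_map {U V : P.FullSubcategory} (e : U ⟶ V) [Epi e.hom] : Epi (F.map e) := by
  rw [← isDeflation_shortExactSequences_iff]
  exact hF.map_deflation ((hP.isDeflation_iff e).2 inferInstance)

/-- Morphisms out of `F.obj U` descend along `F.map e`, for an epimorphism `e : U ⟶ V`,
if they are killed by the maps `k : K ⟶ U` with `k ≫ e = 0`. -/
lemma exists_desc {U V : P.FullSubcategory} (e : U ⟶ V) [Epi e.hom] {Z : B} (φ : F.obj U ⟶ Z)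
    (hφ : ∀ (K : P.FullSubcategory) (k : K ⟶ U), k ≫ e = 0 → F.map k ≫ φ = 0) :
    ∃ ψ : F.obj V ⟶ Z, F.map e ≫ ψ = φ := by
  obtain ⟨K, k, h, hS⟩ := (hP.isDeflation_iff e).2 inferInstance
  exact hF.exists_desc hS φ (hφ K k h)

section

variable {P₁ P₀ : P.FullSubcategory} {a : P₁ ⟶ P₀} {X : A} {p : P₀.obj ⟶ X} [Epi p]
  {w : a.hom ≫ p = 0} (ex : (ShortComplex.mk a.hom p w).Exact) {Z : B} (φ : F.obj P₀ ⟶ Z)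
  (hφ : F.map a ≫ φ = 0)

include ex hφ

omit [Epi p] in
/-- A morphism which vanishes on the relations `a` of a presentation vanishes on all morphisms that
become zero in `X`. -/
lemma map_comp_eq_zero {W : P.FullSubcategory} (k : W ⟶ P₀) (hk : k.hom ≫ p = 0) :
    F.map k ≫ φ = 0 := by
  obtain ⟨U, e, x, _, h⟩ := hP.exists_lift_of_exact ex k.hom hk
  have := hP.epi_map hF e
  have h' : e ≫ k = P.homMk x ≫ a := by ext; exact h
  rw [← cancel_epi (F.map e), ← F.map_comp_assoc, h', F.map_comp_assoc, hφ, comp_zero, comp_zero]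

omit [Epi p] in
lemma map_comp_congr {W : P.FullSubcategory} (k k' : W ⟶ P₀) (hk : k.hom ≫ p = k'.hom ≫ p) :
    F.map k ≫ φ = F.map k' ≫ φ := by
  have := hF.additive
  rw [← sub_eq_zero, ← Preadditive.sub_comp, ← F.map_sub]
  exact hP.map_comp_eq_zero hF ex φ hφ (k - k') (by
    rw [show (k - k').hom = k.hom - k'.hom from rfl, Preadditive.sub_comp, hk, sub_self])

/-- A morphism `φ : F.obj P₀ ⟶ Z` which vanishes on the relations of a presentation of `X` induces
a compatible family of morphisms `F.obj V ⟶ Z` indexed by the morphisms `v : V ⟶ X`. -/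
lemma exists_leg {V : P.FullSubcategory} (v : V.obj ⟶ X) :
    ∃ ψ : F.obj V ⟶ Z, ∀ (W : P.FullSubcategory) (w₁ : W ⟶ V) (w₀ : W ⟶ P₀),
      w₁.hom ≫ v = w₀.hom ≫ p → F.map w₁ ≫ ψ = F.map w₀ ≫ φ := by
  obtain ⟨U, e, x, _, h⟩ := hP.exists_lift v p
  obtain ⟨ψ, hψ⟩ := hP.exists_desc hF e (F.map (P.homMk x) ≫ φ) (fun K k hk => by
    rw [← F.map_comp_assoc]
    refine hP.map_comp_eq_zero hF ex φ hφ _ ?_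
    have hk : k.hom ≫ e.hom = 0 := congrArg (·.hom) hk
    change (k.hom ≫ x) ≫ p = 0
    rw [Category.assoc, ← h, reassoc_of% hk, zero_comp])
  refine ⟨ψ, fun W w₁ w₀ hw => ?_⟩
  -- `ψ` is known on `U`, so the equation is checked on a refinement of `W` that maps to `U`
  obtain ⟨L, l, y, _, hl⟩ := hP.exists_lift w₁.hom e.hom
  have := hP.epi_map hF l
  have hl' : l ≫ w₁ = P.homMk y ≫ e := by ext; exact hl
  rw [← cancel_epi (F.map l), ← F.map_comp_assoc, hl', F.map_comp_assoc, hψ,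
    ← F.map_comp_assoc, ← F.map_comp_assoc]
  refine hP.map_comp_congr hF ex φ hφ _ _ ?_
  simp [← h, ← hw, reassoc_of% hl]

/-- The compatible family of morphisms given by `exists_leg`. -/
def leg {V : P.FullSubcategory} (v : V.obj ⟶ X) : F.obj V ⟶ Z :=
  (hP.exists_leg hF ex φ hφ v).choose

lemma map_comp_leg {V W : P.FullSubcategory} (v : V.obj ⟶ X) (w₁ : W ⟶ V) (w₀ : W ⟶ P₀)
    (h : w₁.hom ≫ v = w₀.hom ≫ p) :
    F.map w₁ ≫ hP.leg hF ex φ hφ v = F.map w₀ ≫ φ :=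
  (hP.exists_leg hF ex φ hφ v).choose_spec W w₁ w₀ h

lemma leg_self : hP.leg hF ex φ hφ p = φ := by
  have := hP.map_comp_leg hF ex φ hφ p (𝟙 P₀) (𝟙 P₀) rfl
  rwa [F.map_id, Category.id_comp, Category.id_comp] at this

lemma map_comp_leg' {V V' : P.FullSubcategory} (v' : V'.obj ⟶ X) (g : V ⟶ V') (v : V.obj ⟶ X)
    (hv : g.hom ≫ v' = v) :
    F.map g ≫ hP.leg hF ex φ hφ v' = hP.leg hF ex φ hφ v := by
  obtain ⟨U, e, x, _, h⟩ := hP.exists_lift v p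
  have := hP.epi_map hF e
  rw [← cancel_epi (F.map e), hP.map_comp_leg hF ex φ hφ v e (P.homMk x) h, ← F.map_comp_assoc,
    hP.map_comp_leg hF ex φ hφ v' (e ≫ g) (P.homMk x) (by simp [← h, hv])]

/-- The cocone with point `Z` on the diagram computing the pointwise left Kan extension of `F`
at `X`. -/
def legCocone : Cocone (CostructuredArrow.proj P.ι X ⋙ F) where
  pt := Z
  ι :=
    { app v := hP.leg hF ex φ hφ v.hom
      naturality v v' g := by
        refine Eq.trans ?_ (Category.comp_id _).symm
        exact hP.map_comp_leg' hF ex φ hφ v'.hom g.left v.hom (CostructuredArrow.w g) }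

end

omit hP hF in
/-- The component at `v : V ⟶ X` of a cocone on the diagram computing the pointwise left Kan
extension of `F` at `X`. -/
def coconeLeg {X : A} (c : Cocone (CostructuredArrow.proj P.ι X ⋙ F)) {V : P.FullSubcategory}
    (v : V.obj ⟶ X) : F.obj V ⟶ c.pt :=
  c.ι.app (CostructuredArrow.mk (Y := V) (S := P.ι) v)

omit hP hF [Abelian A] [Abelian B] in
lemma map_comp_coconeLeg {X : A} (c : Cocone (CostructuredArrow.proj P.ι X ⋙ F))
    {V V' W : P.FullSubcategory} (v : V.obj ⟶ X) (v' : V'.obj ⟶ X) (w₁ : W ⟶ V)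
    (w₀ : W ⟶ V') (h : w₁.hom ≫ v = w₀.hom ≫ v') :
    F.map w₁ ≫ coconeLeg c v = F.map w₀ ≫ coconeLeg c v' :=
  let x : CostructuredArrow P.ι X := CostructuredArrow.mk (Y := W) (S := P.ι) (w₁.hom ≫ v)
  (c.w (CostructuredArrow.homMk (f := x) (f' := CostructuredArrow.mk v) w₁ rfl)).trans
    (c.w (CostructuredArrow.homMk (f := x) (f' := CostructuredArrow.mk v') w₀ h.symm)).symm

omit hP in
lemma map_comp_coconeLeg_eq_zero {X : A} (c : Cocone (CostructuredArrow.proj P.ι X ⋙ F))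
    {P₁ P₀ : P.FullSubcategory} (a : P₁ ⟶ P₀) (p : P₀.obj ⟶ X) (w : a.hom ≫ p = 0) :
    F.map a ≫ coconeLeg c p = 0 := by
  have := hF.additive
  rw [map_comp_coconeLeg c p p a 0 (by rw [w]; exact zero_comp.symm), F.map_zero, zero_comp]

/-- The colimit computing the pointwise left Kan extension at `X` is the cokernel of the image
of a presentation of `X`. -/
def isColimitOfIsCokernel {P₁ P₀ : P.FullSubcategory} {a : P₁ ⟶ P₀} {X : A} {p : P₀.obj ⟶ X}
    [Epi p] (w : a.hom ≫ p = 0) (c : Cocone (CostructuredArrow.proj P.ι X ⋙ F))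
    (hc : IsColimit (CokernelCofork.ofπ (coconeLeg c p)
      (map_comp_coconeLeg_eq_zero hF c a p w))) : IsColimit c :=
  have fac (s : Cocone (CostructuredArrow.proj P.ι X ⋙ F)) :
      coconeLeg c p ≫ hc.desc (CokernelCofork.ofπ _ (map_comp_coconeLeg_eq_zero hF s a p w)) =
        coconeLeg s p :=
    hc.fac (CokernelCofork.ofπ _ (map_comp_coconeLeg_eq_zero hF s a p w)) .one
  { desc s := hc.desc (CokernelCofork.ofπ _ (map_comp_coconeLeg_eq_zero hF s a p w))
    fac s v := by
      obtain ⟨U, e, x, _, h⟩ := hP.exists_lift v.hom p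
      have := hP.epi_map hF e
      change coconeLeg c v.hom ≫ _ = coconeLeg s v.hom
      rw [← cancel_epi (F.map e), ← Category.assoc, map_comp_coconeLeg c v.hom p e (P.homMk x) h,
        map_comp_coconeLeg s v.hom p e (P.homMk x) h, Category.assoc, fac]
    uniq s m hm := Cofork.IsColimit.hom_ext hc ((hm _).trans (fac s).symm) }

/-- Right exact functors on `P` have a pointwise left Kan extension to the abelian category, whose
value at `X` is the cokernel of the image of a presentation of `X`. -/
lemma hasPointwiseLeftKanExtension : P.ι.HasPointwiseLeftKanExtension F := fun X => by
  obtain ⟨P₁, P₀, a, p, w, _, ex⟩ := hP.exists_presentation X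
  let c := hP.legCocone hF ex (cokernel.π (F.map a)) (cokernel.condition _)
  refine ⟨c, hP.isColimitOfIsCokernel hF w c ?_⟩
  exact (cokernelIsCokernel (F.map a)).ofIsoColimit
    (Cofork.ext (Iso.refl _) ((Category.comp_id _).trans
      (hP.leg_self hF ex (cokernel.π (F.map a)) (cokernel.condition _)).symm))

section

variable {E : P.ι.LeftExtension F} (hE : E.IsPointwiseLeftKanExtension)
  {P₁ P₀ : P.FullSubcategory} {a : P₁ ⟶ P₀} {X : A} {p : P₀.obj ⟶ X}

variable (E) in
/-- The morphism `F V ⟶ G X` attached to `v : V ⟶ X`, for an extension `G` of `F`. -/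
def extLeg {V : P.FullSubcategory} (v : V.obj ⟶ X) : F.obj V ⟶ E.right.obj X :=
  E.hom.app V ≫ E.right.map v

omit hP hF [Abelian A] [Abelian B] in
lemma map_comp_extLeg {V V' W : P.FullSubcategory} (v : V.obj ⟶ X) (v' : V'.obj ⟶ X) (w₁ : W ⟶ V)
    (w₀ : W ⟶ V') (h : w₁.hom ≫ v = w₀.hom ≫ v') :
    F.map w₁ ≫ extLeg E v = F.map w₀ ≫ extLeg E v' :=
  map_comp_coconeLeg (E.coconeAt X) v v' w₁ w₀ h

omit hP hF [Abelian A] [Abelian B] in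
lemma extLeg_comp_map {Y : A} (f : X ⟶ Y) : extLeg E p ≫ E.right.map f = extLeg E (p ≫ f) := by
  rw [extLeg, extLeg, Category.assoc, E.right.map_comp]

variable [Epi p]

include hE

/-- Covering `X` by an object of `P` gives an epimorphism onto the value of the pointwise left Kan
extension at `X`. -/
lemma epi_leftExtension : Epi (extLeg E p) := ⟨fun {Z} f g hfg => by
  refine (hE X).hom_ext fun v => ?_
  obtain ⟨U, e, x, _, h⟩ := hP.exists_lift v.hom p
  have := hP.epi_map hF e
  change extLeg E v.hom ≫ f = extLeg E v.hom ≫ g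
  rw [← cancel_epi (F.map e), ← Category.assoc, ← Category.assoc,
    map_comp_extLeg v.hom p e (P.homMk x) h, Category.assoc, Category.assoc, hfg]⟩

/-- The value of the pointwise left Kan extension at `X` has the universal property of the cokernel
of the image of a presentation of `X`. -/
lemma exists_desc_leftExtension {w : a.hom ≫ p = 0} (ex : (ShortComplex.mk a.hom p w).Exact)
    {Z : B} (φ : F.obj P₀ ⟶ Z) (hφ : F.map a ≫ φ = 0) :
    ∃ ψ : E.right.obj X ⟶ Z, extLeg E p ≫ ψ = φ :=
  ⟨(hE X).desc (hP.legCocone hF ex φ hφ), ((hE X).fac (hP.legCocone hF ex φ hφ)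
    (CostructuredArrow.mk (Y := P₀) (S := P.ι) p)).trans (hP.leg_self hF ex φ hφ)⟩

omit [Epi p] in
/-- The pointwise left Kan extension is additive: given `f g : X ⟶ Y` and a cover of `X` by an
object of `P`, both morphisms lift to a cover of `Y` on a common refinement in `P`, where `F` is
additive. -/
lemma additive_leftExtension : E.right.Additive where
  map_add {X Y f g} := by
    have := hF.additive
    obtain ⟨P₁, P₀, a, p, w, _, ex⟩ := hP.exists_presentation X
    obtain ⟨Q₁, Q₀, b, q, w', _, ex'⟩ := hP.exists_presentation Y
    obtain ⟨U, e, x, _, hx⟩ := hP.exists_lift (p ≫ f) q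
    obtain ⟨V, e', y, _, hy⟩ := hP.exists_lift (e.hom ≫ p ≫ g) q
    have := hP.epi_leftExtension hF hE (p := p)
    have := hP.epi_map hF e
    have := hP.epi_map hF e'
    have h₁ := map_comp_extLeg (E := E) (p ≫ f) q (e' ≫ e) (e' ≫ P.homMk x) (by
      simpa using e'.hom ≫= hx)
    have h₂ := map_comp_extLeg (E := E) (p ≫ g) q (e' ≫ e) (P.homMk y) (by simpa using hy)
    have h₃ := map_comp_extLeg (E := E) (p ≫ (f + g)) q (e' ≫ e) (e' ≫ P.homMk x + P.homMk y) (by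
      rw [Preadditive.comp_add, Preadditive.comp_add]
      refine Eq.trans ?_ (Preadditive.add_comp ..).symm
      refine congrArg₂ _ ?_ ?_
      · simpa using e'.hom ≫= hx
      · simpa using hy)
    have : Epi (F.map (e' ≫ e)) := by rw [F.map_comp]; infer_instance
    rw [← cancel_epi (extLeg E p), Preadditive.comp_add, extLeg_comp_map, extLeg_comp_map,
      extLeg_comp_map, ← cancel_epi (F.map (e' ≫ e)), h₃, Preadditive.comp_add, h₁, h₂,
      F.map_add, Preadditive.add_comp]

/-- The pointwise left Kan extension of a right exact functor is right exact. -/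
lemma isRightExact_leftExtension :
    IsRightExact (shortExactSequences A) (shortExactSequences B) E.right := by
  have := hP.additive_leftExtension hF hE
  refine isRightExact_of_exists_desc inferInstance ?_ ?_
  · intro T hT
    have := ShortComplex.ShortExact.epi_g hT
    obtain ⟨P₁, P₀, a, p, w, _, ex⟩ := hP.exists_presentation T.X₂
    have := hP.epi_leftExtension hF hE (p := p ≫ T.g)
    rw [← extLeg_comp_map] at this
    exact epi_of_epi (extLeg E p) _
  · intro T hT Z φ hφ
    have hT : T.ShortExact := hT
    have := hT.epi_g
    have := hT.mono_f
    obtain ⟨P₁, P₀, a, p, w, _, ex⟩ := hP.exists_presentation T.X₂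
    -- a presentation of `T.X₃` whose generators are those of `T.X₂`
    obtain ⟨R, r, hR, _⟩ := hP.exists_epi (kernel (p ≫ T.g))
    let b : (⟨R, hR⟩ : P.FullSubcategory) ⟶ P₀ := P.homMk (r ≫ kernel.ι (p ≫ T.g))
    have wb : b.hom ≫ p ≫ T.g = 0 := by simp [b]
    have exb : (ShortComplex.mk b.hom (p ≫ T.g) wb).Exact := by
      rw [ShortComplex.exact_iff_epi_kernel_lift]
      convert (inferInstance : Epi r)
      ext; simp [b]
    have hp := hP.epi_leftExtension hF hE (p := p)
    have hb : F.map b ≫ extLeg E p ≫ φ = 0 := by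
      obtain ⟨x, hx⟩ : ∃ x, x ≫ T.f = b.hom ≫ p :=
        ⟨hT.exact.lift (b.hom ≫ p) (by simpa using wb), hT.exact.lift_f _ _⟩
      have := map_comp_extLeg (E := E) p (x ≫ T.f) b (𝟙 _) (by
        rw [hx]; exact (Category.id_comp _).symm)
      rw [← Category.assoc, this, ← extLeg_comp_map, Category.assoc, Category.assoc, hφ,
        comp_zero, comp_zero]
    obtain ⟨ψ, hψ⟩ := hP.exists_desc_leftExtension hF hE exb _ hb
    refine ⟨ψ, ?_⟩
    rw [← cancel_epi (extLeg E p), ← hψ, ← Category.assoc, extLeg_comp_map]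

end

end

include hP

/-- A right exact functor `G` on `A` is the left Kan extension of its restriction to `P`: it sends
a presentation of `X` to a presentation of `G.obj X`. -/
lemma isLeftKanExtension {G : A ⥤ B}
    (hG : IsRightExact (shortExactSequences A) (shortExactSequences B) G) :
    G.IsLeftKanExtension (𝟙 (P.ι ⋙ G)) := by
  let E : P.ι.LeftExtension (P.ι ⋙ G) := Functor.LeftExtension.mk G (𝟙 (P.ι ⋙ G))
  have := hG.additive
  have hF := (isRightExact_ι (P := P)).comp isDeflation_shortExactSequences_comp hG
  have hE (X : A) : Nonempty (E.IsPointwiseLeftKanExtensionAt X) := by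
    obtain ⟨P₁, P₀, a, p, w, _, ex⟩ := hP.exists_presentation X
    refine ⟨hP.isColimitOfIsCokernel hF w _ ?_⟩
    have epi_map {Y Z : A} (d : Y ⟶ Z) [Epi d] : Epi (G.map d) := by
      rw [← isDeflation_shortExactSequences_iff]
      exact hG.map_deflation ((isDeflation_shortExactSequences_iff d).2 inferInstance)
    have hleg : coconeLeg (E.coconeAt X) p = G.map p := Category.id_comp _
    have := epi_map p
    have : Epi (coconeLeg (E.coconeAt X) p) := by rw [hleg]; exact this
    refine CokernelCofork.IsColimit.ofπ' _ _ fun {Z} φ hφ => ?_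
    have hφ' : G.map (kernel.ι p) ≫ φ = 0 := by
      have : Epi (kernel.lift p a.hom w) := ex.epi_kernelLift
      have := epi_map (kernel.lift p a.hom w)
      rw [← cancel_epi (G.map (kernel.lift p a.hom w)), ← G.map_comp_assoc, kernel.lift_ι,
        comp_zero]
      exact hφ
    have h := hG.exists_desc (shortExact_kernel p) φ hφ'
    exact ⟨h.choose, by rw [hleg]; exact h.choose_spec⟩
  exact Functor.LeftExtension.IsPointwiseLeftKanExtension.isLeftKanExtension (E := E)
    fun X => (hE X).some

/-- An abelian category is the right abelian envelope of each of its resolving subcategories.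
Left Kan extension along the inclusion is inverse to restriction. -/
theorem isRightAbelianEnvelope : IsRightAbelianEnvelope.{w, t}
    (inducedConflations (shortExactSequences A) P) P.ι where
  isAbelian := ⟨inferInstance, rfl⟩
  isExactCategory := hP.isExactCategory
  isRightExact := isRightExact_ι
  isEquivalence B _ _ :=
    { faithful := ⟨fun {G H} f g h => by
        have := hP.isLeftKanExtension G.property
        ext1
        refine G.obj.hom_ext_of_isLeftKanExtension (𝟙 (P.ι ⋙ G.obj)) _ _ ?_
        exact (Category.id_comp _).trans
          ((congrArg (·.hom) h).trans (Category.id_comp _).symm)⟩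
      full := ⟨fun {G H} f => by
        have := hP.isLeftKanExtension G.property
        refine ⟨ObjectProperty.homMk
          (G.obj.descOfIsLeftKanExtension (𝟙 (P.ι ⋙ G.obj)) H.obj f.hom), ?_⟩
        ext1
        have := G.obj.descOfIsLeftKanExtension_fac (𝟙 (P.ι ⋙ G.obj)) H.obj f.hom
        rwa [Category.id_comp] at this⟩
      essSurj := ⟨fun F => by
        have := hP.hasPointwiseLeftKanExtension F.property
        have hE := P.ι.pointwiseLeftKanExtensionIsPointwiseLeftKanExtension F.obj
        have : IsIso (P.ι.pointwiseLeftKanExtensionUnit F.obj) := hE.isIso_hom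
        refine ⟨⟨P.ι.pointwiseLeftKanExtension F.obj, hP.isRightExact_leftExtension F.property hE⟩,
          ⟨(ObjectProperty.fullyFaithfulι _).preimageIso
            (asIso (P.ι.pointwiseLeftKanExtensionUnit F.obj)).symm⟩⟩⟩ }

end IsResolving

/-! ### Restriction of modules and quasi-coherent modules on affine schemes -/

open AlgebraicGeometry Scheme.Modules Opposite ZeroObject

section Restriction

variable {X Y : Scheme.{u}}

instance preservesFiniteLimits_toPresheaf_evaluation (U : X.Opens) :
    PreservesFiniteLimits (toPresheaf X ⋙ (evaluation _ _).obj (op U)) :=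
  have : PreservesFiniteLimits ((evaluation (X.Opens)ᵒᵖ Ab.{u}).obj (op U)) :=
    ⟨fun _ _ _ => inferInstance⟩
  comp_preservesFiniteLimits _ _

instance additive_toPresheaf : (toPresheaf X).Additive where
  map_add := rfl

/-- Restriction along an open immersion is left exact, because on underlying presheaves it is
composition with the functor of images of open subsets. -/
instance preservesFiniteLimits_restrictFunctor (j : X ⟶ Y) [IsOpenImmersion j] :
    PreservesFiniteLimits (restrictFunctor j) := by
  let e : restrictFunctor j ⋙ toPresheaf X ≅ toPresheaf Y ⋙
      (Functor.whiskeringLeft _ _ _).obj j.opensFunctor.op := Iso.refl _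
  have : PreservesFiniteLimits (toPresheaf Y ⋙
      (Functor.whiskeringLeft _ _ Ab).obj j.opensFunctor.op) :=
    have : PreservesFiniteLimits ((Functor.whiskeringLeft _ _ Ab.{u}).obj j.opensFunctor.op) :=
      ⟨fun _ _ _ => inferInstance⟩
    comp_preservesFiniteLimits _ _
  have : PreservesFiniteLimits (restrictFunctor j ⋙ toPresheaf X) :=
    preservesFiniteLimits_of_natIso e.symm
  exact ⟨fun J _ _ =>
    have : PreservesLimitsOfShape J (restrictFunctor j ⋙ toPresheaf X) := inferInstance
    preservesLimitsOfShape_of_reflects_of_preserves (restrictFunctor j) (toPresheaf X)⟩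

instance additive_restrictFunctor (j : X ⟶ Y) [IsOpenImmersion j] :
    (restrictFunctor j).Additive where
  map_add := rfl

/-- Sections over `U` form a left exact functor. -/
lemma exact_toPresheaf {T : ShortComplex X.Modules} (hT : T.Exact) [Mono T.f] (U : X.Opens)
    (m : Γ(T.X₂, U)) (hm : T.g.app U m = 0) : ∃ k, T.f.app U k = m := by
  let F := toPresheaf X ⋙ (evaluation _ _).obj (op U)
  have := (ShortComplex.ab_exact_iff _).1
    (hT.map_of_mono_of_preservesKernel F inferInstance inferInstance)
  exact this m hm

lemma injective_app_of_mono {M N : X.Modules} (f : M ⟶ N) [Mono f] (U : X.Opens) :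
    Function.Injective (f.app U) := by
  let F := toPresheaf X ⋙ (evaluation _ _).obj (op U)
  exact (AddCommGrpCat.mono_iff_injective (F.map f)).1 inferInstance

end Restriction

section Spec

variable {R : CommRingCat.{u}}

/-- The basic open subset `D(f)` of `Spec R`, as an open subset of the scheme. -/
def basicOpen (f : R) : (Spec R).Opens := PrimeSpectrum.basicOpen f

/-- Global sections of modules over `Spec R`, as a functor to `R`-modules. -/
def specΓ (R : CommRingCat.{u}) : (Spec R).Modules ⥤ ModuleCat.{u} R := moduleSpecΓFunctor (R := R)

instance : (specΓ R).IsRightAdjoint := (tilde.adjunction (R := R)).isRightAdjoint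

instance : (specΓ R).Additive where
  map_add := rfl

variable (R) in
/-- The functor sending an `R`-module to the associated sheaf on `Spec R`. -/
def tildeSpec : ModuleCat.{u} R ⥤ (Spec R).Modules := tilde.functor R

instance : (tildeSpec R).IsLeftAdjoint := inferInstanceAs (tilde.functor R).IsLeftAdjoint

instance : (tildeSpec R).Additive := inferInstanceAs (tilde.functor R).Additive

instance : (tildeSpec R).Full := inferInstanceAs (tilde.functor R).Full

/-- A module on `Spec R` is quasi-coherent if and only if it is associated to an `R`-module. -/
lemma isQuasicoherent_iff_exists {M : (Spec R).Modules} :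
    M.IsQuasicoherent ↔ (tildeSpec R).essImage M := by
  rw [isQuasicoherent_iff_isIso_fromTildeΓ, isIso_fromTildeΓ_iff]
  exact Iff.rfl

/-- The restriction of global sections to an open subset, as an `R`-linear map. -/
def resₗ (M : (Spec R).Modules) (U : (Spec R).Opens) : Γ(M, ⊤) →ₗ[R] Γ(M, U) where
  toFun := M.presheaf.map U.leTop.op
  map_add' := map_add _
  map_smul' := map_smul_Spec _

/-- A module on `Spec R` is quasi-coherent if and only if its sections over `D(f)` are the
localization at `f` of its global sections. -/
lemma isQuasicoherent_iff_isLocalizedModule {M : (Spec R).Modules} :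
    M.IsQuasicoherent ↔ ∀ f : R, IsLocalizedModule.Away f (resₗ M (basicOpen f)) := by
  rw [isQuasicoherent_iff_isIso_fromTildeΓ, isIso_fromTildeΓ_iff_isLocalizing]
  exact Iff.rfl

/-- The map on sections over `U` induced by a morphism of modules, as an `R`-linear map. -/
def appₗ {M N : (Spec R).Modules} (φ : M ⟶ N) (U : (Spec R).Opens) : Γ(M, U) →ₗ[R] Γ(N, U) where
  toFun := φ.app U
  map_add' := map_add _
  map_smul' _ := Hom.app_smul φ _

lemma appₗ_resₗ {M N : (Spec R).Modules} (φ : M ⟶ N) (f : R) (t : Γ(M, ⊤)) :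
    appₗ φ (basicOpen f) (resₗ M (basicOpen f) t) = resₗ N (basicOpen f) (appₗ φ ⊤ t) :=
  ConcreteCategory.congr_hom (φ.mapPresheaf.naturality (basicOpen f).leTop.op) t

/-- A kernel of quasi-coherent modules on an affine scheme is quasi-coherent, because localization
of modules is exact. -/
lemma isQuasicoherent_kernel {M N : (Spec R).Modules} [hM : M.IsQuasicoherent]
    [hN : N.IsQuasicoherent] (φ : M ⟶ N) : (kernel φ).IsQuasicoherent := by
  rw [isQuasicoherent_iff_isLocalizedModule] at hM hN ⊢
  intro f
  have := hM f
  have := hN f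
  have hker (U : (Spec R).Opens) (m : Γ(M, U)) (hm : appₗ φ U m = 0) :
      ∃ k, appₗ (kernel.ι φ) U k = m :=
    exact_toPresheaf (ShortComplex.exact_of_f_is_kernel
      (ShortComplex.mk (kernel.ι φ) φ (kernel.condition φ)) (kernelIsKernel φ)) U m hm
  have hinj (U : (Spec R).Opens) : Function.Injective (appₗ (kernel.ι φ) U) :=
    injective_app_of_mono (kernel.ι φ) U
  have h0 (U : (Spec R).Opens) (t : Γ(kernel φ, U)) : appₗ φ U (appₗ (kernel.ι φ) U t) = 0 := by
    have : (kernel.ι φ ≫ φ).app U t = 0 := by rw [kernel.condition]; rfl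
    exact this
  refine IsLocalizedModule.Away.mk_of_addCommGroup
    (isUnit_algebraMap_end_of_le_basicOpen f le_rfl) ?_ ?_
  · intro s
    obtain ⟨⟨t, ⟨_, n, rfl⟩⟩, ht⟩ := IsLocalizedModule.surj (.powers f) (resₗ M (basicOpen f))
      (appₗ (kernel.ι φ) _ s)
    replace ht : f ^ n • appₗ (kernel.ι φ) _ s = resₗ M (basicOpen f) t := ht
    obtain ⟨⟨_, m, rfl⟩, hm⟩ := (IsLocalizedModule.eq_zero_iff (.powers f) (resₗ N (basicOpen f))
      (m := appₗ φ ⊤ t)).1 (by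
        rw [← appₗ_resₗ, ← ht, _root_.map_smul, h0, smul_zero])
    replace hm : f ^ m • appₗ φ ⊤ t = 0 := hm
    obtain ⟨k, hk⟩ := hker ⊤ (f ^ m • t) (by rw [_root_.map_smul, hm])
    refine ⟨m + n, k, hinj _ ?_⟩
    rw [_root_.map_smul, appₗ_resₗ, hk, _root_.map_smul, ← ht, pow_add, mul_smul]
  · intro t ht
    obtain ⟨⟨_, n, rfl⟩, hn⟩ := (IsLocalizedModule.eq_zero_iff (.powers f) (resₗ M (basicOpen f))
      (m := appₗ (kernel.ι φ) ⊤ t)).1 (by rw [← appₗ_resₗ, ht, map_zero])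
    replace hn : f ^ n • appₗ (kernel.ι φ) ⊤ t = 0 := hn
    exact ⟨n, hinj ⊤ (by rw [map_zero, _root_.map_smul, hn])⟩

/-- A cokernel of quasi-coherent modules on an affine scheme is quasi-coherent. -/
lemma isQuasicoherent_cokernel {M N : (Spec R).Modules} [hM : M.IsQuasicoherent]
    [hN : N.IsQuasicoherent] (φ : M ⟶ N) : (cokernel φ).IsQuasicoherent := by
  rw [isQuasicoherent_iff_exists] at hM hN ⊢
  obtain ⟨A, ⟨a⟩⟩ := hM
  obtain ⟨B, ⟨b⟩⟩ := hN
  let g := (tildeSpec R).preimage (a.hom ≫ φ ≫ b.inv)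
  have hg : (tildeSpec R).map g = a.hom ≫ φ ≫ b.inv := (tildeSpec R).map_preimage _
  exact ⟨cokernel g, ⟨PreservesCokernel.iso (tildeSpec R) g ≪≫
    cokernel.mapIso _ _ a b (by rw [hg]; simp)⟩⟩

/-- Global sections of quasi-coherent modules on an affine scheme are right exact. -/
lemma epi_specΓ_map {M N : (Spec R).Modules} [hM : M.IsQuasicoherent] [hN : N.IsQuasicoherent]
    (φ : M ⟶ N) [Epi φ] : Epi ((specΓ R).map φ) := by
  let M' : (SheafOfModules.isQuasicoherent (Spec R).ringCatSheaf).FullSubcategory := ⟨M, hM⟩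
  let N' : (SheafOfModules.isQuasicoherent (Spec R).ringCatSheaf).FullSubcategory := ⟨N, hN⟩
  let φ' : M' ⟶ N' := ObjectProperty.homMk φ
  have : Epi φ' := (ObjectProperty.ι _).epi_of_epi_map (inferInstanceAs (Epi φ))
  exact inferInstanceAs (Epi ((tildeEquiv (R := R)).inverse.map φ'))

end Spec

/-! ### Generating sections over open subsets and along open immersions -/

section Over

variable {X U : Scheme.{u}} (j : U ⟶ X) [IsOpenImmersion j]

/-- The functor `restrictFunctor j`, between the categories of sheaves of modules that
`Scheme.Modules` abbreviates. -/
def sheafRestrict : SheafOfModules.{u} X.ringCatSheaf ⥤ SheafOfModules.{u} U.ringCatSheaf :=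
  restrictFunctor j

instance : PreservesColimitsOfSize.{u, u} (sheafRestrict j) :=
  inferInstanceAs (PreservesColimitsOfSize.{u, u} (restrictFunctor j))

/-- Sheaves of modules over the site of open subsets of `W` are modules over the scheme `W`. -/
def sheafOverEquiv (W : X.Opens) : SheafOfModules.{u} (X.ringCatSheaf.over W) ≌
    SheafOfModules.{u} (W : Scheme.{u}).ringCatSheaf :=
  overEquiv W

/-- Restriction along an open immersion `j` with range in `W`, for modules given over the site of
open subsets of `W`. -/
def restrictOver {W : X.Opens} (hj : j.opensRange ≤ W) :
    SheafOfModules.{u} (X.ringCatSheaf.over W) ⥤ SheafOfModules.{u} U.ringCatSheaf :=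
  (sheafOverEquiv W).functor ⋙ sheafRestrict (IsOpenImmersion.lift W.ι j
    (by simpa [← SetLike.coe_subset_coe] using hj))

instance {W : X.Opens} (hj : j.opensRange ≤ W) :
    PreservesColimitsOfSize.{u, u} (restrictOver j hj) :=
  comp_preservesColimits _ _

/-- The functor `restrictOver` preserves the structure sheaf. -/
def restrictOverUnitIso {W : X.Opens} (hj : j.opensRange ≤ W) :
    SheafOfModules.unit U.ringCatSheaf ≅
      (restrictOver j hj).obj (SheafOfModules.unit (X.ringCatSheaf.over W)) :=
  (restrictUnitIso _).symm

/-- Restriction to an open subset `W` followed by `restrictOver` is restriction. -/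
def restrictOverIso {W : X.Opens} (hj : j.opensRange ≤ W) (M : SheafOfModules.{u} X.ringCatSheaf) :
    (restrictOver j hj).obj (M.over W) ≅ (sheafRestrict j).obj M :=
  ((Functor.associator _ _ _).symm ≪≫
    Functor.isoWhiskerRight (overFunctorEquiv _) _ ≪≫
    (restrictFunctorComp _ _).symm ≪≫ restrictFunctorCongr (by simp) :
      SheafOfModules.overFunctor X.ringCatSheaf W ⋙ restrictOver j hj ≅ sheafRestrict j).app M

/-- Generating sections over an open subset containing the range of `j` restrict along `j`. -/
def generatingSectionsRestrict {M : SheafOfModules.{u} X.ringCatSheaf} {W : X.Opens}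
    (hj : j.opensRange ≤ W) (G : (M.over W).GeneratingSections) :
    ((sheafRestrict j).obj M).GeneratingSections :=
  (G.map (restrictOver j hj) (restrictOverUnitIso j hj)).ofEpi (restrictOverIso j hj M).hom

lemma isFiniteType_generatingSectionsRestrict {M : SheafOfModules.{u} X.ringCatSheaf}
    {W : X.Opens} (hj : j.opensRange ≤ W) (G : (M.over W).GeneratingSections) [G.IsFiniteType] :
    (generatingSectionsRestrict j hj G).IsFiniteType :=
  ⟨inferInstanceAs (Finite G.I)⟩

lemma isIso_generatingSectionsRestrict_π {M : SheafOfModules.{u} X.ringCatSheaf}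
    {W : X.Opens} (hj : j.opensRange ≤ W) (G : (M.over W).GeneratingSections) [IsIso G.π] :
    IsIso (generatingSectionsRestrict j hj G).π := by
  rw [generatingSectionsRestrict, SheafOfModules.GeneratingSections.ofEpi_π,
    SheafOfModules.GeneratingSections.map_π_eq]
  exact IsIso.comp_isIso' (IsIso.comp_isIso' (Iso.isIso_hom _) inferInstance) (Iso.isIso_hom _)

/-- Extension to the site of open subsets of the range of an open immersion `j`. -/
def extendOver : SheafOfModules.{u} U.ringCatSheaf ⥤
    SheafOfModules.{u} (X.ringCatSheaf.over j.opensRange) :=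
  sheafRestrict j.isoOpensRange.inv ⋙ (sheafOverEquiv j.opensRange).inverse

instance : PreservesColimitsOfSize.{u, u} (extendOver j) :=
  comp_preservesColimits _ _

/-- The functor `extendOver` preserves the structure sheaf. -/
def extendOverUnitIso : SheafOfModules.unit (X.ringCatSheaf.over j.opensRange) ≅
    (extendOver j).obj (SheafOfModules.unit U.ringCatSheaf) :=
  (sheafOverEquiv j.opensRange).unitIso.app _ ≪≫
    (sheafOverEquiv j.opensRange).inverse.mapIso (restrictUnitIso j.isoOpensRange.inv).symm

/-- Restriction along `j` followed by `extendOver` is restriction to the range of `j`. -/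
def extendOverIso (M : SheafOfModules.{u} X.ringCatSheaf) :
    (extendOver j).obj ((sheafRestrict j).obj M) ≅ M.over j.opensRange :=
  (sheafOverEquiv j.opensRange).inverse.mapIso
    (((restrictFunctorComp _ _).symm ≪≫ restrictFunctorCongr (by simp) ≪≫
      (overFunctorEquiv _).symm).app M) ≪≫ (sheafOverEquiv j.opensRange).unitIso.symm.app _

/-- Generating sections of the restriction along `j` give generating sections over the range
of `j`. -/
def generatingSectionsOver {M : SheafOfModules.{u} X.ringCatSheaf}
    (G : ((sheafRestrict j).obj M).GeneratingSections) :
    (M.over j.opensRange).GeneratingSections :=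
  (G.map (extendOver j) (extendOverUnitIso j)).ofEpi (extendOverIso j M).hom

instance {M : SheafOfModules.{u} X.ringCatSheaf}
    (G : ((sheafRestrict j).obj M).GeneratingSections)
    [G.IsFiniteType] : (generatingSectionsOver j G).IsFiniteType :=
  ⟨inferInstanceAs (Finite G.I)⟩

instance {M : SheafOfModules.{u} X.ringCatSheaf}
    (G : ((sheafRestrict j).obj M).GeneratingSections) [IsIso G.π] :
    IsIso (generatingSectionsOver j G).π := by
  rw [generatingSectionsOver, SheafOfModules.GeneratingSections.ofEpi_π,
    SheafOfModules.GeneratingSections.map_π_eq]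
  exact IsIso.comp_isIso' (IsIso.comp_isIso' (Iso.isIso_hom _) inferInstance) (Iso.isIso_hom _)

/-- A presentation of the restriction along `j` gives a presentation over the range of `j`. -/
def presentationOver {M : SheafOfModules.{u} X.ringCatSheaf}
    (P : ((sheafRestrict j).obj M).Presentation) :
    (M.over j.opensRange).Presentation :=
  (P.map (extendOver j) (extendOverUnitIso j)).ofIsIso (extendOverIso j M).hom

end Over

section Local

variable {X : Scheme.{u}}

lemma coversTop_opensRange {I : Type*} {U : I → Scheme.{u}} (j : ∀ i, U i ⟶ X)
    [∀ i, IsOpenImmersion (j i)] (h : ∀ x : X, ∃ i, x ∈ (j i).opensRange) :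
    (Opens.grothendieckTopology X).CoversTop fun i ↦ (j i).opensRange := by
  rw [Opens.coversTop_iff]
  ext x
  simpa using h x

/-- A presentation of a quasi-coherent module on an affine scheme. -/
def presentationOfIsQuasicoherent {R : CommRingCat.{u}} {M : (Spec R).Modules}
    (hM : M.IsQuasicoherent) : SheafOfModules.Presentation (R := (Spec R).ringCatSheaf) M :=
  let e : SheafOfModules.Presentation (R := (Spec R).ringCatSheaf)
      (tilde ((specΓ R).obj M)) :=
    presentationTilde _ _ (Submodule.span_univ) _ (Submodule.span_eq _)
  have : IsIso (C := SheafOfModules (Spec R).ringCatSheaf) M.fromTildeΓ :=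
    inferInstanceAs (IsIso M.fromTildeΓ)
  e.ofIsIso (N := M) M.fromTildeΓ

/-- Quasi-coherence is local. -/
lemma isQuasicoherent_of_restrict {M : X.Modules}
    (h : ∀ x : X, ∃ (R : CommRingCat.{u}) (j : Spec R ⟶ X) (_ : IsOpenImmersion j),
      x ∈ j.opensRange ∧ (M.restrict j).IsQuasicoherent) : M.IsQuasicoherent := by
  choose R j hj hx h using h
  have P (x : X) : ((sheafRestrict (j x)).obj M).Presentation :=
    presentationOfIsQuasicoherent (h x)
  exact SheafOfModules.QuasicoherentData.isQuasicoherent.{u, u, u, u}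
    (R := X.ringCatSheaf) (M := M)
    { I := X
      X := fun x ↦ (j x).opensRange
      coversTop := coversTop_opensRange j fun x ↦ ⟨x, hx x⟩
      presentation := fun x ↦ presentationOver (j x) (P x) }

/-- A module has finite type if it is generated by finitely many sections in a neighbourhood of each
point. -/
lemma isFiniteType_of_restrict {M : SheafOfModules.{u} X.ringCatSheaf}
    (h : ∀ x : X, ∃ (R : CommRingCat.{u}) (j : Spec R ⟶ X) (_ : IsOpenImmersion j)
      (G : ((sheafRestrict j).obj M).GeneratingSections),
        x ∈ j.opensRange ∧ G.IsFiniteType) :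
    M.IsFiniteType := by
  choose R j hj G hx hG using h
  let q : SheafOfModules.LocalGeneratorsData.{u} M :=
    { I := X
      X := fun x ↦ (j x).opensRange
      coversTop := coversTop_opensRange j fun x ↦ ⟨x, hx x⟩
      generators := fun x ↦ generatingSectionsOver (j x) (G x) }
  have hq (x : X) : (generatingSectionsOver (j x) (G x)).IsFiniteType :=
    have := hG x
    inferInstance
  have : q.IsFiniteType := .mk (p := q) hq
  exact SheafOfModules.IsFiniteType.mk (M := M) ⟨q, this⟩

/-- A module is locally free of finite rank if it has a finite basis in a neighbourhood of each
point. -/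
lemma isLocallyFreeOfFiniteRank_of_restrict {M : SheafOfModules.{u} X.ringCatSheaf}
    (h : ∀ x : X, ∃ (R : CommRingCat.{u}) (j : Spec R ⟶ X) (_ : IsOpenImmersion j)
      (G : ((sheafRestrict j).obj M).GeneratingSections),
        x ∈ j.opensRange ∧ G.IsFiniteType ∧ IsIso G.π) :
    isLocallyFreeOfFiniteRank X M := by
  choose R j hj G hx hG hG' using h
  let q : SheafOfModules.LocalGeneratorsData.{u} M :=
    { I := X
      X := fun x ↦ (j x).opensRange
      coversTop := coversTop_opensRange j fun x ↦ ⟨x, hx x⟩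
      generators := fun x ↦ generatingSectionsOver (j x) (G x) }
  have hq (x : X) : (generatingSectionsOver (j x) (G x)).IsFiniteType :=
    have := hG x
    inferInstance
  have hq' (x : X) : IsIso (generatingSectionsOver (j x) (G x)).π :=
    have := hG' x
    inferInstance
  exact ⟨q, .mk (q := q) hq', .mk (p := q) hq⟩

/-- Every neighbourhood of a point contains the range of an open immersion `Spec R ⟶ X`. -/
lemma exists_openImmersion (W : X.Opens) (x : X) (hx : x ∈ W) :
    ∃ (R : CommRingCat.{u}) (j : Spec R ⟶ X) (_ : IsOpenImmersion j),
      x ∈ j.opensRange ∧ j.opensRange ≤ W := by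
  obtain ⟨V, (hV : IsAffineOpen V), hxV, hVW⟩ :=
    TopologicalSpace.Opens.isBasis_iff_nbhd.1 X.isBasis_affineOpens hx
  exact ⟨_, hV.fromSpec, hV.isOpenImmersion_fromSpec,
    by rwa [hV.opensRange_fromSpec], by rwa [hV.opensRange_fromSpec]⟩

lemma exists_mem_of_coversTop {I : Type*} {W : I → X.Opens}
    (h : (Opens.grothendieckTopology X).CoversTop W) (x : X) : ∃ i, x ∈ W i := by
  rw [Opens.coversTop_iff] at h
  have : x ∈ ⨆ i, W i := h ▸ TopologicalSpace.Opens.mem_top x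
  simpa using this

end Local

/-! ### Finite and free quasi-coherent modules on affine schemes -/

section SpecGenerators

variable {R : CommRingCat.{u}}

variable (R) in
/-- The free module on a set `I` over `Spec R`. -/
def freeSpec (I : Type u) : (Spec R).Modules := SheafOfModules.free I

/-- The sheaf associated to a free `R`-module is free. -/
def tildeFreeIso (I : Type u) : (tildeSpec R).obj (ModuleCat.of R (I →₀ R)) ≅ freeSpec R I :=
  tildeFinsupp I

/-- A quasi-coherent module on an affine scheme is associated to its global sections. -/
def tildeΓIso (M : (Spec R).Modules) [h : M.IsQuasicoherent] :
    (tildeSpec R).obj ((specΓ R).obj M) ≅ M :=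
  @asIso _ _ _ _ M.fromTildeΓ ((isQuasicoherent_iff_isIso_fromTildeΓ M).1 h)

/-- Global sections of a free module on an affine scheme. -/
def specΓFreeIso (I : Type u) : (specΓ R).obj (freeSpec R I) ≅ ModuleCat.of R (I →₀ R) :=
  (specΓ R).mapIso (tildeFreeIso I).symm ≪≫
    (tilde.toTildeΓNatIso.app (ModuleCat.of R (I →₀ R))).symm

instance isQuasicoherent_freeSpec (I : Type u) : (freeSpec R I).IsQuasicoherent :=
  isQuasicoherent_iff_exists.2 ⟨_, ⟨tildeFreeIso I⟩⟩

/-- The morphism from a free module given by generating sections. -/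
def generatingHom {M : (Spec R).Modules}
    (G : SheafOfModules.GeneratingSections (R := (Spec R).ringCatSheaf) M) :
    freeSpec R G.I ⟶ M :=
  G.π

lemma finite_specΓ_of_generatingSections {M : (Spec R).Modules} [M.IsQuasicoherent]
    (G : SheafOfModules.GeneratingSections (R := (Spec R).ringCatSheaf) M) (hG : G.IsFiniteType) :
    Module.Finite R ((specΓ R).obj M) := by
  have : Epi (generatingHom G) := G.epi
  have : Epi ((specΓ R).map (generatingHom G)) := epi_specΓ_map _
  have : Finite G.I := hG.finite
  exact Module.Finite.of_surjective ((specΓFreeIso G.I).inv ≫ (specΓ R).map (generatingHom G)).hom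
    ((ModuleCat.epi_iff_surjective _).1 inferInstance)

lemma free_specΓ_of_generatingSections {M : (Spec R).Modules}
    (G : SheafOfModules.GeneratingSections (R := (Spec R).ringCatSheaf) M) (hG : IsIso G.π) :
    Module.Free R ((specΓ R).obj M) := by
  have : IsIso (generatingHom G) := hG
  exact Module.Free.of_equiv
    ((specΓFreeIso G.I).symm ≪≫ (specΓ R).mapIso (asIso (generatingHom G))).toLinearEquiv

/-- The morphism of sheaves given by a linear map from a free module to the global sections of a
quasi-coherent module. -/
def freeSpecHom {M : (Spec R).Modules} [M.IsQuasicoherent] {I : Type u}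
    (φ : ModuleCat.of R (I →₀ R) ⟶ (specΓ R).obj M) :
    freeSpec R I ⟶ M :=
  (tildeFreeIso I).inv ≫ (tildeSpec R).map φ ≫ (tildeΓIso M).hom

/-- Generating sections of a module on an affine scheme, from an epimorphism from a free module. -/
def generatingSectionsOfEpi {M : (Spec R).Modules} {I : Type u} (p : freeSpec R I ⟶ M)
    (hp : Epi p) : SheafOfModules.GeneratingSections (R := (Spec R).ringCatSheaf) M where
  I := I
  s := SheafOfModules.freeHomEquiv (R := (Spec R).ringCatSheaf) M p
  epi := by
    have h := (SheafOfModules.freeHomEquiv (R := (Spec R).ringCatSheaf) M).symm_apply_apply p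
    exact h.symm ▸ hp

lemma generatingSectionsOfEpi_π {M : (Spec R).Modules} {I : Type u} (p : freeSpec R I ⟶ M)
    (hp : Epi p) : (generatingSectionsOfEpi p hp).π = p :=
  (SheafOfModules.freeHomEquiv (R := (Spec R).ringCatSheaf) M).symm_apply_apply p

lemma exists_epi_of_finite (N : ModuleCat.{u} R) [Module.Finite R N] :
    ∃ (I : Type u) (_ : Finite I) (φ : ModuleCat.of R (I →₀ R) ⟶ N), Epi φ := by
  obtain ⟨s, hs⟩ := Module.Finite.fg_top (R := R) (M := N)
  let φ : (s →₀ R) →ₗ[R] N := Finsupp.linearCombination R Subtype.val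
  refine ⟨s, inferInstance, ModuleCat.ofHom φ, (ModuleCat.epi_iff_surjective _).2 ?_⟩
  change Function.Surjective φ
  rw [← LinearMap.range_eq_top, Finsupp.range_linearCombination]
  simpa using hs

lemma exists_generatingSections_of_finite (M : (Spec R).Modules) [M.IsQuasicoherent]
    [Module.Finite R ((specΓ R).obj M)] :
    ∃ G : SheafOfModules.GeneratingSections (R := (Spec R).ringCatSheaf) M, G.IsFiniteType := by
  obtain ⟨I, hI, φ, hφ⟩ := exists_epi_of_finite ((specΓ R).obj M)
  have : Epi (freeSpecHom φ) := by
    unfold freeSpecHom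
    infer_instance
  exact ⟨generatingSectionsOfEpi _ this, ⟨hI⟩⟩

lemma exists_generatingSections_of_free (M : (Spec R).Modules) [M.IsQuasicoherent]
    [Module.Finite R ((specΓ R).obj M)] [Module.Free R ((specΓ R).obj M)] :
    ∃ G : SheafOfModules.GeneratingSections (R := (Spec R).ringCatSheaf) M,
      G.IsFiniteType ∧ IsIso G.π := by
  let b := Module.Free.chooseBasis R ((specΓ R).obj M)
  let e : ModuleCat.of R (_ →₀ R) ≅ (specΓ R).obj M := b.repr.symm.toModuleIso
  have : IsIso (freeSpecHom e.hom) := by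
    unfold freeSpecHom
    infer_instance
  refine ⟨generatingSectionsOfEpi (freeSpecHom e.hom) inferInstance,
    ⟨inferInstanceAs (Finite (Module.Free.ChooseBasisIndex R ((specΓ R).obj M)))⟩, ?_⟩
  rw [generatingSectionsOfEpi_π]
  exact this

end SpecGenerators

section SpecLocalization

variable {R S : CommRingCat.{u}}

lemma isLocalizedModule_resₗ (M : (Spec R).Modules) [hM : M.IsQuasicoherent] (f : R)
    (U : (Spec R).Opens) (hU : U = basicOpen f) : IsLocalizedModule.Away f (resₗ M U) := by
  subst hU
  exact isQuasicoherent_iff_isLocalizedModule.1 hM f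

lemma specMap_image_top (φ : R ⟶ S) (f : R) [Algebra R S]
    (hφ : φ = CommRingCat.ofHom (algebraMap R S)) [IsLocalization.Away f S]
    [IsOpenImmersion (Spec.map φ)] :
    Spec.map φ ''ᵁ ⊤ = basicOpen f := by
  subst hφ
  apply TopologicalSpace.Opens.ext
  rw [Scheme.Hom.image_top_eq_opensRange]
  exact PrimeSpectrum.localization_away_comap_range S f

/-- A finite projective module is free on a basic open neighbourhood of each prime ideal. -/
lemma exists_free_localizedModule_away {A : Type u} [CommRing A] (N : Type u) [AddCommGroup N]
    [Module A N] [Module.Finite A N] [Module.Projective A N] (𝔭 : PrimeSpectrum A) :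
    ∃ f ∉ 𝔭.asIdeal, Module.Free (Localization.Away f) (LocalizedModule.Away f N) := by
  have : Module.FinitePresentation A N := Module.finitePresentation_of_projective A N
  have : Module.Free (Localization 𝔭.asIdeal.primeCompl)
      (LocalizedModule 𝔭.asIdeal.primeCompl N) := by
    have h : 𝔭 ∈ Module.freeLocus A N := by
      rw [Module.freeLocus_eq_univ]
      trivial
    exact h
  obtain ⟨f, hf, hfree, -⟩ := Module.FinitePresentation.exists_free_localizedModule_powers
    𝔭.asIdeal.primeCompl (LocalizedModule.mkLinearMap 𝔭.asIdeal.primeCompl N)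
    (Localization 𝔭.asIdeal.primeCompl)
  exact ⟨f, hf, hfree⟩

lemma free_of_isLocalizedModule_away {A : Type u} [CommRing A] {N N' : Type u} [AddCommGroup N]
    [Module A N] [AddCommGroup N'] [Module A N'] (f : A) [Module (Localization.Away f) N']
    [IsScalarTower A (Localization.Away f) N'] (l : N →ₗ[A] N') [IsLocalizedModule.Away f l]
    (h : Module.Free (Localization.Away f) (LocalizedModule.Away f N)) :
    Module.Free (Localization.Away f) N' :=
  Module.Free.of_equiv ((IsLocalizedModule.iso (.powers f) l).extendScalarsOfIsLocalization
    (.powers f) (Localization.Away f))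

/-- If the global sections of a quasi-coherent module on an affine scheme are finite projective,
then they become free on a neighbourhood of any given point. -/
lemma exists_free_restrict (M : (Spec R).Modules) [hM : M.IsQuasicoherent]
    [hfin : Module.Finite R ((specΓ R).obj M)] [hproj : Module.Projective R ((specΓ R).obj M)]
    (x : Spec R) : ∃ (S : CommRingCat.{u}) (φ : R ⟶ S) (_ : IsOpenImmersion (Spec.map φ)),
      x ∈ (Spec.map φ).opensRange ∧ Module.Finite S ((specΓ S).obj (M.restrict (Spec.map φ))) ∧
        Module.Free S ((specΓ S).obj (M.restrict (Spec.map φ))) := by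
  let 𝔭 : PrimeSpectrum R := x
  obtain ⟨f, hf, hfree⟩ := exists_free_localizedModule_away ((specΓ R).obj M) 𝔭
  let φ : R ⟶ CommRingCat.of (Localization.Away f) :=
    CommRingCat.ofHom (algebraMap R (Localization.Away f))
  have hφ : IsOpenImmersion (Spec.map φ) := Scheme.isOpenImmersion_SpecMap_localizationAway f
  have hU := specMap_image_top φ f rfl
  refine ⟨_, φ, hφ, ?_, ?_⟩
  · rw [← Scheme.Hom.image_top_eq_opensRange, hU]
    exact hf
  -- sections of the restriction to `D(f)` are a localization of the global sections
  let N' := (specΓ (CommRingCat.of (Localization.Away f))).obj (M.restrict (Spec.map φ))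
  let : Module R N' := Module.compHom _ (algebraMap R (Localization.Away f))
  have : IsScalarTower R (Localization.Away f) N' := .of_algebraMap_smul fun _ _ ↦ rfl
  let r : (specΓ R).obj M →ₗ[R] Γ(M, Spec.map φ ''ᵁ ⊤) := resₗ M (Spec.map φ ''ᵁ ⊤)
  have : IsLocalizedModule.Away f r := isLocalizedModule_resₗ M f _ hU
  let e : N' ≃ₗ[R] Γ(M, Spec.map φ ''ᵁ ⊤) :=
    { (M.restrictAppIso (Spec.map φ) ⊤).addCommGroupIsoToAddEquiv with
      map_smul' := fun r m ↦ restrictAppIso_smul_Spec φ r m }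
  let l : (specΓ R).obj M →ₗ[R] N' := e.symm.toLinearMap ∘ₗ r
  have : IsLocalizedModule.Away f l := IsLocalizedModule.of_linearEquiv _ _ _
  exact ⟨Module.Finite.of_isLocalizedModule (.powers f) l, free_of_isLocalizedModule_away f l hfree⟩

end SpecLocalization

/-! ### Coherent and locally free sheaves in terms of affine sections -/

section AffineSections

variable {X : Scheme.{u}} {R : CommRingCat.{u}} (j : Spec R ⟶ X) [IsOpenImmersion j]

/-- The sections of modules on `X` over an affine open subset, given as the range of an open
immersion `Spec R ⟶ X`, as a functor to `R`-modules. -/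
def affineSections : X.Modules ⥤ ModuleCat.{u} R := restrictFunctor j ⋙ specΓ R

instance : (affineSections j).Additive :=
  inferInstanceAs (restrictFunctor j ⋙ specΓ R).Additive

instance : PreservesFiniteLimits (affineSections j) :=
  comp_preservesFiniteLimits _ _

/-- Sections over affine open subsets are exact on short exact sequences of quasi-coherent
modules. -/
lemma shortExact_map_affineSections {T : ShortComplex X.Modules} (hT : T.ShortExact)
    (h₂ : T.X₂.IsQuasicoherent) (h₃ : T.X₃.IsQuasicoherent) :
    (T.map (affineSections j)).ShortExact := by
  have := hT.mono_f
  have := hT.epi_g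
  have : ((restrictFunctor j).obj T.X₂).IsQuasicoherent := inferInstance
  have : ((restrictFunctor j).obj T.X₃).IsQuasicoherent := inferInstance
  exact
  { exact := hT.exact.map_of_mono_of_preservesKernel _ inferInstance inferInstance
    mono_f := inferInstanceAs (Mono ((affineSections j).map T.f))
    epi_g := epi_specΓ_map ((restrictFunctor j).map T.g) }

/-- Sections over the range of a composition of open immersions. -/
def affineSectionsCompIso {S : CommRingCat.{u}} (k : Spec S ⟶ Spec R) [IsOpenImmersion k]
    (M : X.Modules) :
    (affineSections (k ≫ j)).obj M ≅ (specΓ S).obj ((M.restrict j).restrict k) :=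
  (specΓ S).mapIso ((restrictFunctorComp k j).app M)

/-- Sections that generate `M` over `W` also generate its sections over each affine open subset
of `W`, and they remain a basis if they form one. -/
lemma affineSections_of_generatingSections {M : X.Modules} (hM : M.IsQuasicoherent) {W : X.Opens}
    (hj : j.opensRange ≤ W)
    (G : (SheafOfModules.over (R := X.ringCatSheaf) M W).GeneratingSections)
    (hG : G.IsFiniteType) :
    Module.Finite R ((affineSections j).obj M) ∧
      (IsIso G.π → Module.Free R ((affineSections j).obj M)) := by
  have : (M.restrict j).IsQuasicoherent :=
    inferInstanceAs ((restrictFunctor j).obj M).IsQuasicoherent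
  constructor
  · have := isFiniteType_generatingSectionsRestrict j hj G
    exact finite_specΓ_of_generatingSections (M := M.restrict j)
      (generatingSectionsRestrict j hj G) this
  · intro h
    have := isIso_generatingSectionsRestrict_π j hj G
    exact free_specΓ_of_generatingSections (M := M.restrict j)
      (generatingSectionsRestrict j hj G) this

end AffineSections

section Characterizations

variable {X : Scheme.{u}}

/-- Each point has a neighbourhood `W` such that the sections of a given coherent sheaf over all
affine open subsets of `W` are finite modules. Since `W` can be shrunk, several sheaves can be
treated simultaneously. -/
lemma exists_finite_affineSections {M : X.Modules} (hM : isCoherent X M) (x : X) :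
    ∃ W : X.Opens, x ∈ W ∧ ∀ (R : CommRingCat.{u}) (j : Spec R ⟶ X) [IsOpenImmersion j],
      j.opensRange ≤ W → Module.Finite R ((affineSections j).obj M) := by
  obtain ⟨q, hq⟩ := hM.2.exists_localGeneratorsData
  obtain ⟨i, hi⟩ := exists_mem_of_coversTop q.coversTop x
  exact ⟨q.X i, hi, fun R j _ hj ↦ (affineSections_of_generatingSections j hM.1 hj
    (q.generators i) (hq.isFiniteType i)).1⟩

/-- A quasi-coherent module is coherent if its sections over sufficiently many affine open subsets
are finite modules. -/
lemma isCoherent_of_affineSections {M : X.Modules} (hM : M.IsQuasicoherent)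
    (h : ∀ x : X, ∃ (R : CommRingCat.{u}) (j : Spec R ⟶ X) (_ : IsOpenImmersion j),
      x ∈ j.opensRange ∧ Module.Finite R ((affineSections j).obj M)) : isCoherent X M := by
  refine ⟨hM, isFiniteType_of_restrict fun x ↦ ?_⟩
  obtain ⟨R, j, hj, hx, hfin⟩ := h x
  have : (M.restrict j).IsQuasicoherent :=
    inferInstanceAs ((restrictFunctor j).obj M).IsQuasicoherent
  have : Module.Finite R ((specΓ R).obj (M.restrict j)) := hfin
  obtain ⟨G, hG⟩ := exists_generatingSections_of_finite (M.restrict j)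
  exact ⟨R, j, hj, G, hx, hG⟩

lemma isCoherent_of_isLocallyFreeOfFiniteRank {M : X.Modules} (hM : isLocallyFreeOfFiniteRank X M) :
    isCoherent X M := by
  obtain ⟨q, hq, hq'⟩ := hM
  exact ⟨q.quasiCoherentData.isQuasicoherent, SheafOfModules.IsFiniteType.mk (M := M) ⟨q, hq'⟩⟩

lemma exists_free_affineSections {M : X.Modules} (hM : isLocallyFreeOfFiniteRank X M) (x : X) :
    ∃ W : X.Opens, x ∈ W ∧ ∀ (R : CommRingCat.{u}) (j : Spec R ⟶ X) [IsOpenImmersion j],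
      j.opensRange ≤ W → Module.Finite R ((affineSections j).obj M) ∧
        Module.Free R ((affineSections j).obj M) := by
  have hqc := (isCoherent_of_isLocallyFreeOfFiniteRank hM).1
  obtain ⟨q, hq, hq'⟩ := hM
  obtain ⟨i, hi⟩ := exists_mem_of_coversTop q.coversTop x
  refine ⟨q.X i, hi, fun R j _ hj ↦ ?_⟩
  have h := affineSections_of_generatingSections j hqc hj (q.generators i) (hq'.isFiniteType i)
  exact ⟨h.1, h.2 (hq.isIso i)⟩

/-- A quasi-coherent module is locally free of finite rank if its sections over sufficiently many
affine open subsets are finite projective modules. -/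
lemma isLocallyFreeOfFiniteRank_of_affineSections {M : X.Modules} (hM : M.IsQuasicoherent)
    (h : ∀ x : X, ∃ (R : CommRingCat.{u}) (j : Spec R ⟶ X) (_ : IsOpenImmersion j),
      x ∈ j.opensRange ∧ Module.Finite R ((affineSections j).obj M) ∧
        Module.Projective R ((affineSections j).obj M)) : isLocallyFreeOfFiniteRank X M := by
  refine isLocallyFreeOfFiniteRank_of_restrict fun x ↦ ?_
  obtain ⟨R, j, hj, ⟨y, hy⟩, hfin, hproj⟩ := h x
  have : (M.restrict j).IsQuasicoherent :=
    inferInstanceAs ((restrictFunctor j).obj M).IsQuasicoherent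
  obtain ⟨S, φ, hφ, ⟨z, hz⟩, hfin', hfree⟩ :=
    exists_free_restrict (M.restrict j) (hfin := hfin) (hproj := hproj) y
  have : (M.restrict (Spec.map φ ≫ j)).IsQuasicoherent :=
    inferInstanceAs ((restrictFunctor _).obj M).IsQuasicoherent
  let e := (affineSectionsCompIso j (Spec.map φ) M).symm.toLinearEquiv
  have : Module.Finite S ((specΓ S).obj (M.restrict (Spec.map φ ≫ j))) := Module.Finite.equiv e
  have : Module.Free S ((specΓ S).obj (M.restrict (Spec.map φ ≫ j))) := Module.Free.of_equiv e
  obtain ⟨G, hG, hG'⟩ := exists_generatingSections_of_free (M.restrict (Spec.map φ ≫ j))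
  exact ⟨S, Spec.map φ ≫ j, inferInstance, G, ⟨z, by simp [hz, hy]⟩, hG, hG'⟩

end Characterizations

section Quasicoherent

variable {X : Scheme.{u}} {M N : X.Modules}

lemma isQuasicoherent_of_iso (e : M ≅ N) (hM : M.IsQuasicoherent) : N.IsQuasicoherent :=
  (SheafOfModules.isQuasicoherent X.ringCatSheaf).prop_of_iso e hM

lemma isQuasicoherent_of_forall_restrict (h : ∀ (R : CommRingCat.{u}) (j : Spec R ⟶ X)
    [IsOpenImmersion j], (M.restrict j).IsQuasicoherent) : M.IsQuasicoherent := by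
  refine isQuasicoherent_of_restrict fun x ↦ ?_
  obtain ⟨R, j, hj, hx, -⟩ := exists_openImmersion ⊤ x trivial
  exact ⟨R, j, hj, hx, h R j⟩

lemma isQuasicoherent_kernel_of_isQuasicoherent (hM : M.IsQuasicoherent)
    (hN : N.IsQuasicoherent) (φ : M ⟶ N) : (kernel φ).IsQuasicoherent := by
  refine isQuasicoherent_of_forall_restrict fun R j _ ↦ ?_
  exact isQuasicoherent_of_iso (PreservesKernel.iso (restrictFunctor j) φ).symm
    (isQuasicoherent_kernel ((restrictFunctor j).map φ))

lemma isQuasicoherent_cokernel_of_isQuasicoherent (hM : M.IsQuasicoherent)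
    (hN : N.IsQuasicoherent) (φ : M ⟶ N) : (cokernel φ).IsQuasicoherent := by
  refine isQuasicoherent_of_forall_restrict fun R j _ ↦ ?_
  exact isQuasicoherent_of_iso (PreservesCokernel.iso (restrictFunctor j) φ).symm
    (isQuasicoherent_cokernel ((restrictFunctor j).map φ))

lemma isQuasicoherent_of_isZero (hM : IsZero M) : M.IsQuasicoherent := by
  refine isQuasicoherent_of_forall_restrict fun R j _ ↦ ?_
  rw [isQuasicoherent_iff_exists]
  refine ⟨ModuleCat.of R PUnit, ⟨IsZero.iso ?_ ((restrictFunctor j).map_isZero hM)⟩⟩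
  exact (tildeSpec R).map_isZero (ModuleCat.isZero_of_subsingleton _)

lemma isQuasicoherent_biprod (hM : M.IsQuasicoherent) (hN : N.IsQuasicoherent) :
    (M ⊞ N).IsQuasicoherent := by
  refine isQuasicoherent_of_forall_restrict fun R j _ ↦ ?_
  have : (M.restrict j).IsQuasicoherent :=
    inferInstanceAs ((restrictFunctor j).obj M).IsQuasicoherent
  have : (N.restrict j).IsQuasicoherent :=
    inferInstanceAs ((restrictFunctor j).obj N).IsQuasicoherent
  rw [isQuasicoherent_iff_exists]
  have := preservesBinaryBiproducts_of_preservesBiproducts (tildeSpec R)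
  have := preservesBinaryBiproducts_of_preservesBiproducts (restrictFunctor j)
  exact ⟨(specΓ R).obj (M.restrict j) ⊞ (specΓ R).obj (N.restrict j),
    ⟨(tildeSpec R).mapBiprod _ _ ≪≫
      biprod.mapIso (tildeΓIso (M.restrict j)) (tildeΓIso (N.restrict j)) ≪≫
      ((restrictFunctor j).mapBiprod M N).symm⟩⟩

end Quasicoherent

/-! ### The abelian category of coherent sheaves and its subcategory of locally free sheaves -/

section ModuleSequences

variable {R : Type u} [Ring R] {T : ShortComplex (ModuleCat.{u} R)}

lemma finite_projective_X₂ (hT : T.ShortExact) [Module.Finite R T.X₁] [Module.Projective R T.X₁]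
    [Module.Finite R T.X₃] [h : Module.Projective R T.X₃] :
    Module.Finite R T.X₂ ∧ Module.Projective R T.X₂ := by
  have : Projective T.X₃ := (IsProjective.iff_projective _).1 h
  let e := (hT.splittingOfProjective.isoBinaryBiproduct ≪≫
    ModuleCat.biprodIsoProd T.X₁ T.X₃).toLinearEquiv.symm
  exact ⟨Module.Finite.equiv e, Module.Projective.of_equiv e⟩

lemma finite_projective_X₁ (hT : T.ShortExact) [Module.Finite R T.X₂] [Module.Projective R T.X₂]
    [h : Module.Projective R T.X₃] :
    Module.Finite R T.X₁ ∧ Module.Projective R T.X₁ := by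
  have : Projective T.X₃ := (IsProjective.iff_projective _).1 h
  let s := hT.splittingOfProjective
  have hs (x : T.X₁) : s.r.hom (T.f.hom x) = x := ConcreteCategory.congr_hom s.f_r x
  exact ⟨Module.Finite.of_surjective s.r.hom fun x ↦ ⟨_, hs x⟩,
    Module.Projective.of_split T.f.hom s.r.hom (LinearMap.ext hs)⟩

end ModuleSequences

section Coherent

variable (X : Scheme.{u})

lemma isLocallyFreeOfFiniteRank_of_isZero {M : X.Modules} (hM : IsZero M) :
    isLocallyFreeOfFiniteRank X M := by
  refine isLocallyFreeOfFiniteRank_of_affineSections (isQuasicoherent_of_isZero hM) fun x ↦ ?_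
  obtain ⟨R, j, hj, hx, -⟩ := exists_openImmersion ⊤ x trivial
  have := ModuleCat.subsingleton_of_isZero ((affineSections j).map_isZero hM)
  exact ⟨R, j, hj, hx, inferInstance, inferInstance⟩

instance : (isCoherent X).ContainsZero where
  exists_zero := ⟨0, isZero_zero _, isCoherent_of_isLocallyFreeOfFiniteRank
    (isLocallyFreeOfFiniteRank_of_isZero X (isZero_zero _))⟩

lemma isNoetherianRing_of_isOpenImmersion [IsLocallyNoetherian X] {R : CommRingCat.{u}}
    (j : Spec R ⟶ X) [IsOpenImmersion j] : IsNoetherianRing R :=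
  isLocallyNoetherian_Spec.1 (isLocallyNoetherian_of_isOpenImmersion j)

variable {X} in
lemma isCoherent_of_mono [IsLocallyNoetherian X] {M N : X.Modules} (f : M ⟶ N) [Mono f]
    (hM : M.IsQuasicoherent) (hN : isCoherent X N) : isCoherent X M := by
  refine isCoherent_of_affineSections hM fun x ↦ ?_
  obtain ⟨W, hx, hW⟩ := exists_finite_affineSections hN x
  obtain ⟨R, j, hj, hxj, hjW⟩ := exists_openImmersion W x hx
  have := isNoetherianRing_of_isOpenImmersion X j
  have := hW R j hjW
  exact ⟨R, j, hj, hxj, Module.Finite.of_injective ((affineSections j).map f).hom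
    ((ModuleCat.mono_iff_injective _).1 inferInstance)⟩

variable {X} in
lemma isCoherent_of_epi {M N : X.Modules} (f : M ⟶ N) [Epi f]
    (hM : isCoherent X M) (hN : N.IsQuasicoherent) : isCoherent X N := by
  refine isCoherent_of_affineSections hN fun x ↦ ?_
  obtain ⟨W, hx, hW⟩ := exists_finite_affineSections hM x
  obtain ⟨R, j, hj, hxj, hjW⟩ := exists_openImmersion W x hx
  have := hW R j hjW
  have h := (shortExact_map_affineSections j (IsResolving.shortExact_kernel f) hM.1 hN).epi_g
  exact ⟨R, j, hj, hxj, Module.Finite.of_surjective ((affineSections j).map f).hom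
    ((ModuleCat.epi_iff_surjective _).1 h)⟩

instance : (isCoherent X).IsClosedUnderIsomorphisms where
  of_iso e hM := isCoherent_of_epi e.hom hM (isQuasicoherent_of_iso e hM.1)

instance [IsLocallyNoetherian X] : (isCoherent X).IsClosedUnderKernels where
  kernels_le := by
    rintro _ ⟨f, k, hk, hM, hN⟩
    exact (isCoherent X).prop_of_iso ((kernelIsKernel f).conePointUniqueUpToIso hk)
      (isCoherent_of_mono (kernel.ι f) (isQuasicoherent_kernel_of_isQuasicoherent hM.1 hN.1 f) hM)

instance : (isCoherent X).IsClosedUnderCokernels where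
  cokernels_le := by
    rintro _ ⟨f, k, hk, hM, hN⟩
    exact (isCoherent X).prop_of_iso ((cokernelIsCokernel f).coconePointUniqueUpToIso hk)
      (isCoherent_of_epi (cokernel.π f) hN
          (isQuasicoherent_cokernel_of_isQuasicoherent hM.1 hN.1 f))

instance : (isCoherent X).IsClosedUnderFiniteProducts := by
  refine isClosedUnderFiniteProducts_of_biprod _ fun M N hM hN ↦ ?_
  refine isCoherent_of_affineSections (isQuasicoherent_biprod hM.1 hN.1) fun x ↦ ?_
  obtain ⟨V, hxV, hV⟩ := exists_finite_affineSections hM x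
  obtain ⟨W, hxW, hW⟩ := exists_finite_affineSections hN x
  obtain ⟨R, j, hj, hxj, hjVW⟩ := exists_openImmersion (V ⊓ W) x ⟨hxV, hxW⟩
  have := hV R j (hjVW.trans inf_le_left)
  have := hW R j (hjVW.trans inf_le_right)
  have := preservesBinaryBiproducts_of_preservesBiproducts (affineSections j)
  exact ⟨R, j, hj, hxj, Module.Finite.equiv ((affineSections j).mapBiprod M N ≪≫
    ModuleCat.biprodIsoProd _ _).toLinearEquiv.symm⟩

variable [IsLocallyNoetherian X]

instance : (isCoherent X).ι.PreservesMonomorphisms :=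
  (isCoherent X).preservesMonomorphisms_ι_of_isNormalEpiCategory

instance : (isCoherent X).ι.PreservesEpimorphisms :=
  (isCoherent X).preservesEpimorphisms_ι_of_isNormalMonoCategory

instance : PreservesFiniteLimits (isCoherent X).ι := by
  have := (isCoherent X).preservesKernels_ι
  exact Functor.preservesFiniteLimits_of_preservesKernels _

instance : PreservesFiniteColimits (isCoherent X).ι := by
  have := (isCoherent X).preservesCokernels_ι
  exact Functor.preservesFiniteColimits_of_preservesCokernels _

/-- Sections of a short exact sequence of coherent sheaves over an affine open subset. -/
lemma shortExact_affineSections {T : ShortComplex (Coh X)} (hT : T.ShortExact)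
    {R : CommRingCat.{u}} (j : Spec R ⟶ X) [IsOpenImmersion j] :
    ((T.map (isCoherent X).ι).map (affineSections j)).ShortExact :=
  shortExact_map_affineSections j (hT.map_of_exact _) T.X₂.2.1 T.X₃.2.1

/-- Extensions of locally free sheaves of finite rank are locally free of finite rank: locally, the
sections of the extension form a split extension of free modules. -/
lemma isBun_X₂ {T : ShortComplex (Coh X)} (hT : T.ShortExact) (h₁ : isBun X T.X₁)
    (h₃ : isBun X T.X₃) : isBun X T.X₂ := by
  refine isLocallyFreeOfFiniteRank_of_affineSections T.X₂.2.1 fun x ↦ ?_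
  obtain ⟨V, hxV, hV⟩ := exists_free_affineSections h₁ x
  obtain ⟨W, hxW, hW⟩ := exists_free_affineSections h₃ x
  obtain ⟨R, j, hj, hxj, hjVW⟩ := exists_openImmersion (V ⊓ W) x ⟨hxV, hxW⟩
  let S := (T.map (isCoherent X).ι).map (affineSections j)
  have hS : S.ShortExact := shortExact_affineSections X hT j
  obtain ⟨_, _⟩ : Module.Finite R S.X₁ ∧ Module.Free R S.X₁ := hV R j (hjVW.trans inf_le_left)
  obtain ⟨_, _⟩ : Module.Finite R S.X₃ ∧ Module.Free R S.X₃ := hW R j (hjVW.trans inf_le_right)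
  exact ⟨R, j, hj, hxj, finite_projective_X₂ hS⟩

/-- Kernels of epimorphisms between locally free sheaves of finite rank are locally free of finite
rank: locally, the sections of the kernel are a direct summand of a free module. -/
lemma isBun_X₁ {T : ShortComplex (Coh X)} (hT : T.ShortExact) (h₂ : isBun X T.X₂)
    (h₃ : isBun X T.X₃) : isBun X T.X₁ := by
  refine isLocallyFreeOfFiniteRank_of_affineSections T.X₁.2.1 fun x ↦ ?_
  obtain ⟨V, hxV, hV⟩ := exists_free_affineSections h₂ x
  obtain ⟨W, hxW, hW⟩ := exists_free_affineSections h₃ x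
  obtain ⟨R, j, hj, hxj, hjVW⟩ := exists_openImmersion (V ⊓ W) x ⟨hxV, hxW⟩
  let S := (T.map (isCoherent X).ι).map (affineSections j)
  have hS : S.ShortExact := shortExact_affineSections X hT j
  obtain ⟨_, _⟩ : Module.Finite R S.X₂ ∧ Module.Free R S.X₂ := hV R j (hjVW.trans inf_le_left)
  obtain ⟨_, _⟩ : Module.Finite R S.X₃ ∧ Module.Free R S.X₃ := hW R j (hjVW.trans inf_le_right)
  exact ⟨R, j, hj, hxj, finite_projective_X₁ hS⟩

/-- The resolution property makes the locally free sheaves of finite rank a resolving subcategory of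
the coherent sheaves. -/
lemma isResolving_isBun (hX : HasResolutionProperty X) : IsResolving (isBun X) where
  containsZero := ⟨0, isZero_zero _,
    isLocallyFreeOfFiniteRank_of_isZero X ((isCoherent X).ι.map_isZero (isZero_zero _))⟩
  closedUnderExtensions := ⟨fun {_} hT h₁ h₃ ↦ isBun_X₂ X hT h₁ h₃⟩
  prop_X₁ hT h₂ h₃ := isBun_X₁ X hT h₂ h₃
  exists_epi F := by
    obtain ⟨V, p, hV, hp⟩ := hX F.obj F.2
    exact ⟨⟨V, isCoherent_of_isLocallyFreeOfFiniteRank hV⟩, ObjectProperty.homMk p, hV,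
      (isCoherent X).ι.epi_of_epi_map hp⟩

end Coherent

end AbelianEnvelope

end

theorem mainTheorem11 (X : AlgebraicGeometry.Scheme.{u}) [AlgebraicGeometry.IsNoetherian X]
    (hX : AbelianEnvelope.HasResolutionProperty X) :
    (AbelianEnvelope.isBun X).IsClosedUnderExtensions ∧
    AbelianEnvelope.IsRightAbelianEnvelope.{w, t}
      (AbelianEnvelope.bunConflations X) (AbelianEnvelope.isBun X).ι :=
  ⟨(AbelianEnvelope.isResolving_isBun X hX).closedUnderExtensions,
    (AbelianEnvelope.isResolving_isBun X hX).isRightAbelianEnvelope⟩
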